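/- Let $(X,d)$ be a complete metric space which is quasiconvex: there is $L\ge 1$ such that any two points $x,y\in X$ are joined by a continuous curve of length at most $L\,d(x,y)$. Write $\mathrm{Lip}(X)$ for the space of real-valued Lipschitz functions on $X$, $\mathrm{LIP}(\cdot)$ for the Lipschitz constant, and $\mathrm{Lip}_b(X)\subset\mathrm{Lip}(X)$ for the bounded ones. For $k\ge 0$, a metric $k$-current is a multilinear functional $T\colon \mathrm{Lip}_b(X)\times\mathrm{Lip}(X)^k\to\mathbb{R}$ such that: (locality) $T(f,\pi_1,\dots,\pi_k)=0$ whenever some $\pi_i$ is constant on a neighbourhood of $\{f\ne 0\}$; (joint continuity) $T(f,\pi^n_1,\dots,\pi^n_k)\to T(f,\pi_1,\dots,\pi_k)$ as $n\to\infty$ whenever $f\in\mathrm{Lip}_b(X)$, $\pi_i^n,\pi_i\in\mathrm{Lip}(X)$, $\pi^n_i\to\pi_i$ pointwise on $X$ for every $i$, and $\sup_{i,n}\mathrm{LIP}(\pi_i^n)<\infty$; (finite mass) there is a finite nonnegative Borel measure $\mu$ on $X$ with $|T(f,\pi_1,\dots,\pi_k)|\le\prod_{i=1}^k\mathrm{LIP}(\pi_i)\int_X|f|\,d\mu$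 for all $(f,\pi_1,\dots,\pi_k)$. The least such measure $\mu$ is the mass measure $\|T\|$, and $\mathbf{M}(T):=\|T\|(X)$. A metric $1$-current $T$ is normal if its boundary $\partial T(f):=T(1,f)$, $f\in\mathrm{Lip}_b(X)$, is a metric $0$-current. Theorem. Let $T$ be a metric $1$-current on $X$ whose mass measure $\|T\|$ is inner regular by compact sets, i.e. $\|T\|(B)=\sup\{\|T\|(K)\colon K\subset B\text{ compact}\}$ for every Borel set $B\subset X$. Then there is a sequence $(T_i)_{i\in\mathbb{N}}$ of normal $1$-currents on $X$ such that $\mathbf{M}(T-T_i)\to 0$. -/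

import Mathlib

open MeasureTheory Filter Topology

namespace MetricCurrents

/-- The Lipschitz constant `sup_{y ≠ x} |g x - g y| / d(x, y)` of a Lipschitz function `g`
(the diagonal contributes `0 / 0 = 0`). -/
noncomputable def lipConst {X : Type*} [MetricSpace X] (g : X → ℝ) : ℝ :=
  ⨆ p : X × X, |g p.1 - g p.2| / dist p.1 p.2

/-- The vector space of real-valued Lipschitz functions on `X`. -/
def Lip (X : Type*) [MetricSpace X] : Submodule ℝ (X → ℝ) where
  carrier := {g | ∃ K : NNReal, LipschitzWith K g}
  zero_mem' := ⟨0, LipschitzWith.const 0⟩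
  add_mem' := by
    rintro f g ⟨K, hK⟩ ⟨L, hL⟩
    exact ⟨K + L, hK.add hL⟩
  smul_mem' := by
    rintro c g ⟨K, hK⟩
    exact ⟨‖c‖₊ * K, (lipschitzWith_smul c).comp hK⟩

/-- The vector space of bounded real-valued Lipschitz functions on `X`. -/
def LipB (X : Type*) [MetricSpace X] : Submodule ℝ (X → ℝ) where
  carrier := {g | g ∈ Lip X ∧ ∃ C : ℝ, ∀ x, |g x| ≤ C}
  zero_mem' := ⟨(Lip X).zero_mem, 0, by simp⟩
  add_mem' := by
    rintro f g ⟨hf, C, hC⟩ ⟨hg, D, hD⟩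
    exact ⟨(Lip X).add_mem hf hg, C + D,
      fun x => (abs_add_le _ _).trans (add_le_add (hC x) (hD x))⟩
  smul_mem' := by
    rintro c g ⟨hg, C, hC⟩
    refine ⟨(Lip X).smul_mem c hg, |c| * C, fun x => ?_⟩
    simp only [Pi.smul_apply, smul_eq_mul, abs_mul]
    exact mul_le_mul_of_nonneg_left (hC x) (abs_nonneg c)

theorem lipB_le_lip (X : Type*) [MetricSpace X] : LipB X ≤ Lip X := fun _ h => h.1

/-- The constant function `1`, as a bounded Lipschitz function. -/
def oneLipB (X : Type*) [MetricSpace X] : LipB X :=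
  ⟨fun _ => 1, ⟨0, LipschitzWith.const 1⟩, 1, by simp⟩

/-- The multilinear functionals `(f, π₁, …, π_k) ↦ T (f, π₁, …, π_k)` on
`D^k(X) = Lip_b(X) × Lip(X)^k`. -/
abbrev Functional (X : Type*) [MetricSpace X] (k : ℕ) : Type _ :=
  LipB X →ₗ[ℝ] MultilinearMap ℝ (fun _ : Fin k => Lip X) ℝ

/-- The boundary `∂T (f, π₁, …, π_k) = T (1, f, π₁, …, π_k)`. -/
noncomputable def boundary {X : Type*} [MetricSpace X] {k : ℕ} (T : Functional X (k + 1)) :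
    Functional X k :=
  (T (oneLipB X)).curryLeft ∘ₗ Submodule.inclusion (lipB_le_lip X)

theorem boundary_apply {X : Type*} [MetricSpace X] {k : ℕ} (T : Functional X (k + 1))
    (f : LipB X) (π : Fin k → Lip X) :
    boundary T f π = T (oneLipB X) (Fin.cons (Submodule.inclusion (lipB_le_lip X) f) π) := rfl

/-- `μ` is a finite Borel measure with
`|T (f, π₁, …, π_k)| ≤ ∏ LIP(π_i) ∫ |f| dμ` for all `(f, π₁, …, π_k)`. -/
def IsMassBound {X : Type*} [MetricSpace X] [MeasurableSpace X] {k : ℕ}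
    (T : Functional X k) (μ : Measure X) : Prop :=
  IsFiniteMeasure μ ∧ ∀ (f : LipB X) (π : Fin k → Lip X),
    |T f π| ≤ (∏ i, lipConst (π i : X → ℝ)) * ∫ x, |(f : X → ℝ) x| ∂μ

/-- Metric `k`-currents of Ambrosio and Kirchheim: multilinear functionals on `D^k(X)` that are
local, jointly continuous and of finite mass. -/
structure IsMetricCurrent {X : Type*} [MetricSpace X] [MeasurableSpace X] {k : ℕ}
    (T : Functional X k) : Prop where
  /-- `T (f, π) = 0` if some `π i` is constant on a neighbourhood of `{f ≠ 0}`. -/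
  locality : ∀ (f : LipB X) (π : Fin k → Lip X),
    (∃ i, ∃ U ∈ 𝓝ˢ {x | (f : X → ℝ) x ≠ 0}, ∃ c : ℝ, ∀ x ∈ U, (π i : X → ℝ) x = c) →
    T f π = 0
  joint_continuity : ∀ (f : LipB X) (π : Fin k → Lip X) (πs : ℕ → Fin k → Lip X),
    (∃ L : ℝ, ∀ n i, lipConst (πs n i : X → ℝ) ≤ L) →
    (∀ i x, Tendsto (fun n => (πs n i : X → ℝ) x) atTop (𝓝 ((π i : X → ℝ) x))) →
    Tendsto (fun n => T f (πs n)) atTop (𝓝 (T f π))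
  finite_mass : ∃ μ : Measure X, IsMassBound T μ

/-- The mass measure `‖T‖`: the minimal measure in the finite mass condition
(see `massMeasure_isLeast`). -/
noncomputable def massMeasure {X : Type*} [MetricSpace X] [MeasurableSpace X] {k : ℕ}
    (T : Functional X k) : Measure X :=
  sInf {μ | IsMassBound T μ}

/-- The mass `M(T) = ‖T‖(X)`. -/
noncomputable def mass {X : Type*} [MetricSpace X] [MeasurableSpace X] {k : ℕ}
    (T : Functional X k) : ENNReal :=
  massMeasure T Set.univ

/-- A normal current: a metric current whose boundary is a metric current. -/
def IsNormalCurrent {X : Type*} [MetricSpace X] [MeasurableSpace X] {k : ℕ}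
    (T : Functional X (k + 1)) : Prop :=
  IsMetricCurrent T ∧ IsMetricCurrent (boundary T)

/-- `X` is `L`-quasiconvex for some `L ≥ 1`: any two points `x`, `y` are joined by a continuous
curve of length at most `L * d(x, y)`. -/
def IsQuasiconvex (X : Type*) [MetricSpace X] : Prop :=
  ∃ L : NNReal, 1 ≤ L ∧ ∀ x y : X, ∃ γ : Path x y,
    eVariationOn γ Set.univ ≤ (L : ENNReal) * edist x y

section Minimality

variable {X : Type*} [MetricSpace X] [MeasurableSpace X] [BorelSpace X] {k : ℕ}

theorem measurable_lipB (f : LipB X) : Measurable (f : X → ℝ) := by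
  obtain ⟨⟨K, hK⟩, -⟩ := f.2
  exact hK.continuous.measurable

theorem lipConst_nonneg {Y : Type*} [MetricSpace Y] (g : Y → ℝ) : 0 ≤ lipConst g :=
  Real.iSup_nonneg fun _ => div_nonneg (abs_nonneg _) dist_nonneg

theorem integrable_lipB (f : LipB X) (μ : Measure X) [IsFiniteMeasure μ] :
    Integrable (fun x => |(f : X → ℝ) x|) μ := by
  obtain ⟨-, C, hC⟩ := f.2
  refine Integrable.of_bound (measurable_lipB f).abs.aestronglyMeasurable C ?_
  filter_upwards with x
  simpa using hC x

theorem lintegral_lipB_ne_top (f : LipB X) (μ : Measure X) [IsFiniteMeasure μ] :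
    ∫⁻ x, ENNReal.ofReal |(f : X → ℝ) x| ∂μ ≠ ⊤ := by
  rw [← ofReal_integral_eq_lintegral_ofReal (integrable_lipB f μ)
    (Eventually.of_forall fun x => abs_nonneg _)]
  exact ENNReal.ofReal_ne_top

theorem isMassBound_iff (T : Functional X k) (μ : Measure X) :
    IsMassBound T μ ↔ IsFiniteMeasure μ ∧ ∀ (f : LipB X) (π : Fin k → Lip X),
      ENNReal.ofReal |T f π| ≤ ENNReal.ofReal (∏ i, lipConst (π i : X → ℝ)) *
        ∫⁻ x, ENNReal.ofReal |(f : X → ℝ) x| ∂μ := by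
  refine and_congr_right fun hμ => forall₂_congr fun f π => ?_
  rw [← ofReal_integral_eq_lintegral_ofReal (integrable_lipB f μ)
    (Eventually.of_forall fun x => abs_nonneg _),
    ← ENNReal.ofReal_mul (Finset.prod_nonneg fun i _ => lipConst_nonneg _),
    ENNReal.ofReal_le_ofReal_iff]
  exact mul_nonneg (Finset.prod_nonneg fun i _ => lipConst_nonneg _)
    (integral_nonneg fun x => abs_nonneg _)

/-- Gluing two mass bounds along a closed set. -/
theorem IsMassBound.glue_closed {T : Functional X k} {μ ν : Measure X} (hμ : IsMassBound T μ)
    (hν : IsMassBound T ν) {K : Set X} (hK : IsClosed K) :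
    IsMassBound T (μ.restrict K + ν.restrict Kᶜ) := by
  rw [isMassBound_iff] at hμ hν ⊢
  obtain ⟨hμ1, hμ⟩ := hμ
  obtain ⟨hν1, hν⟩ := hν
  refine ⟨inferInstance, fun f π => ?_⟩
  have hδ : ∀ n : ℕ, (0 : ℝ) < 1 / ((n : ℝ) + 1) := fun n => by positivity
  let φ : ℕ → X → NNReal := fun n => thickenedIndicator (hδ n) K
  have hφ1 : ∀ n x, φ n x ≤ 1 := fun n x => thickenedIndicator_le_one (hδ n) K x
  have hφc : ∀ n, Measurable (φ n) := fun n => (thickenedIndicator (hδ n) K).continuous.measurable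
  have hφl : Tendsto φ atTop (𝓝 (Set.indicator K fun _ => (1 : NNReal))) := by
    have := thickenedIndicator_tendsto_indicator_closure hδ
      tendsto_one_div_add_atTop_nhds_zero_nat K
    rwa [hK.closure_eq] at this
  have hφl' := fun x => (tendsto_pi_nhds.1 hφl) x
  obtain ⟨⟨L, hL⟩, C, hC⟩ := f.2
  let g : ℕ → LipB X := fun n => ⟨fun x => (φ n x : ℝ) * (f : X → ℝ) x, by
    refine ⟨?_, C, fun x => ?_⟩
    · have h1 : LipschitzWith _ (fun x => (φ n x : ℝ)) :=
        (LipschitzWith.of_dist_le_mul (K := 1) (f := ((↑) : NNReal → ℝ)) (by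
          intro a b; simp [NNReal.dist_eq, Real.dist_eq])).comp
          (lipschitzWith_thickenedIndicator (hδ n) K)
      have hC0 : ∀ x, |(f : X → ℝ) x| ≤ (C.toNNReal : ℝ) := fun x =>
        (hC x).trans (Real.le_coe_toNNReal C)
      refine ⟨1 * (1 / ((n : ℝ) + 1)).toNNReal⁻¹ * C.toNNReal + L, ?_⟩
      refine LipschitzWith.of_dist_le_mul fun x y => ?_
      have e1 := h1.dist_le_mul x y
      have e2 := hL.dist_le_mul x y
      rw [Real.dist_eq] at *
      have e3 : (φ n x : ℝ) * (f : X → ℝ) x - (φ n y : ℝ) * (f : X → ℝ) y =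
          ((φ n x : ℝ) - φ n y) * (f : X → ℝ) x
          + (φ n y : ℝ) * ((f : X → ℝ) x - (f : X → ℝ) y) := by ring
      rw [e3]
      refine (abs_add_le _ _).trans ?_
      rw [abs_mul, abs_mul, NNReal.coe_add, NNReal.coe_mul, add_mul]
      refine add_le_add ?_ ?_
      · refine (mul_le_mul e1 (hC0 x) (abs_nonneg _) (by positivity)).trans (le_of_eq (by ring))
      · rw [NNReal.abs_eq]
        refine (mul_le_of_le_one_left (abs_nonneg _) ?_).trans e2
        exact_mod_cast hφ1 n y
    · rw [abs_mul, NNReal.abs_eq]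
      refine (mul_le_of_le_one_left (abs_nonneg _) ?_).trans (hC x)
      exact_mod_cast hφ1 n x⟩
  set c := ENNReal.ofReal (∏ i, lipConst (π i : X → ℝ)) with hc
  have hle : ∀ n, ENNReal.ofReal |T f π| ≤
      c * ((∫⁻ x, ENNReal.ofReal |(g n : X → ℝ) x| ∂μ) +
        ∫⁻ x, ENNReal.ofReal |((f - g n : LipB X) : X → ℝ) x| ∂ν) := by
    intro n
    have : T f π = T (g n) π + T (f - g n) π := by simp
    rw [this, mul_add]
    refine (ENNReal.ofReal_le_ofReal (abs_add_le _ _)).trans ?_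
    rw [ENNReal.ofReal_add (abs_nonneg _) (abs_nonneg _)]
    exact add_le_add (hμ _ _) (hν _ _)
  have t1 : Tendsto (fun n => ∫⁻ x, ENNReal.ofReal |(g n : X → ℝ) x| ∂μ) atTop
      (𝓝 (∫⁻ x in K, ENNReal.ofReal |(f : X → ℝ) x| ∂μ)) := by
    rw [← lintegral_indicator hK.measurableSet]
    refine tendsto_lintegral_of_dominated_convergence _
      (fun n => (measurable_lipB (g n)).abs.ennreal_ofReal) (fun n => ?_)
      (lintegral_lipB_ne_top f μ) (Eventually.of_forall fun x => ?_)
    · refine Eventually.of_forall fun x => ENNReal.ofReal_le_ofReal ?_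
      change |(φ n x : ℝ) * (f : X → ℝ) x| ≤ _
      rw [abs_mul, NNReal.abs_eq]
      exact mul_le_of_le_one_left (abs_nonneg _) (by exact_mod_cast hφ1 n x)
    · have h2 : Tendsto (fun n => ENNReal.ofReal |(φ n x : ℝ) * (f : X → ℝ) x|) atTop
          (𝓝 (ENNReal.ofReal |((Set.indicator K (fun _ => (1 : NNReal)) x : NNReal) : ℝ) *
            (f : X → ℝ) x|)) :=
        ENNReal.tendsto_ofReal (((NNReal.tendsto_coe.2 (hφl' x)).mul_const _).abs)
      convert h2 using 2
      by_cases hx : x ∈ K <;> simp [hx]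
  have t2 : Tendsto (fun n => ∫⁻ x, ENNReal.ofReal |((f - g n : LipB X) : X → ℝ) x| ∂ν) atTop
      (𝓝 (∫⁻ x in Kᶜ, ENNReal.ofReal |(f : X → ℝ) x| ∂ν)) := by
    rw [← lintegral_indicator hK.measurableSet.compl]
    refine tendsto_lintegral_of_dominated_convergence _
      (fun n => (measurable_lipB (f - g n)).abs.ennreal_ofReal) (fun n => ?_)
      (lintegral_lipB_ne_top f ν) (Eventually.of_forall fun x => ?_)
    · refine Eventually.of_forall fun x => ENNReal.ofReal_le_ofReal ?_
      change |(f : X → ℝ) x - (φ n x : ℝ) * (f : X → ℝ) x| ≤ _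
      have e : (f : X → ℝ) x - (φ n x : ℝ) * (f : X → ℝ) x = (1 - (φ n x : ℝ)) * (f : X → ℝ) x := by
        ring
      have e1 : (φ n x : ℝ) ≤ 1 := by exact_mod_cast hφ1 n x
      rw [e, abs_mul, abs_of_nonneg (by linarith)]
      exact mul_le_of_le_one_left (abs_nonneg _) (by linarith [(φ n x).coe_nonneg])
    · have h2 : Tendsto (fun n => ENNReal.ofReal |(f : X → ℝ) x - (φ n x : ℝ) * (f : X → ℝ) x|)
          atTop (𝓝 (ENNReal.ofReal |(f : X → ℝ) x -
            ((Set.indicator K (fun _ => (1 : NNReal)) x : NNReal) : ℝ) * (f : X → ℝ) x|)) :=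
        ENNReal.tendsto_ofReal
          ((((NNReal.tendsto_coe.2 (hφl' x)).mul_const _).const_sub _).abs)
      have e : (Kᶜ).indicator (fun x => ENNReal.ofReal |(f : X → ℝ) x|) x =
          ENNReal.ofReal |(f : X → ℝ) x -
            ((Set.indicator K (fun _ => (1 : NNReal)) x : NNReal) : ℝ) * (f : X → ℝ) x| := by
        by_cases hx : x ∈ K <;> simp [hx]
      rw [e]
      exact h2
  rw [lintegral_add_measure]
  exact ge_of_tendsto' (ENNReal.Tendsto.const_mul (t1.add t2) (Or.inr ENNReal.ofReal_ne_top)) hle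

/-- Any two mass bounds have a common lower bound that is a mass bound. -/
theorem IsMassBound.exists_le {T : Functional X k} {μ ν : Measure X} (hμ : IsMassBound T μ)
    (hν : IsMassBound T ν) : ∃ ρ, IsMassBound T ρ ∧ ρ ≤ μ ∧ ρ ≤ ν := by
  have := hμ.1
  have := hν.1
  obtain ⟨B, hB, h1, h2⟩ := hahn_decomposition ν μ
  refine ⟨μ.restrict B + ν.restrict Bᶜ, ?_, ?_, ?_⟩
  · refine (isMassBound_iff _ _).2 ⟨inferInstance, fun f π => ?_⟩
    obtain ⟨-, C, hC⟩ := f.2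
    set c := ENNReal.ofReal (∏ i, lipConst (π i : X → ℝ)) with hc
    have key : ∀ ε : NNReal, 0 < ε → ENNReal.ofReal |T f π| ≤
        c * ((∫⁻ x, ENNReal.ofReal |(f : X → ℝ) x| ∂(μ.restrict B + ν.restrict Bᶜ)) +
          ENNReal.ofReal C * ε) := by
      intro ε hε
      obtain ⟨K, hKB, hK, hlt⟩ := hB.exists_isClosed_sdiff_lt (measure_ne_top ν B)
        (ε := (ε : ENNReal)) (by exact_mod_cast hε.ne')
      refine (((isMassBound_iff _ _).1 (hμ.glue_closed hν hK)).2 f π).trans ?_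
      gcongr
      rw [lintegral_add_measure, lintegral_add_measure, add_assoc]
      refine add_le_add (lintegral_mono_set hKB) ?_
      have : Kᶜ ⊆ Bᶜ ∪ (B \ K) := by
        intro x hx
        by_cases h : x ∈ B
        · exact Or.inr ⟨h, hx⟩
        · exact Or.inl h
      refine (lintegral_mono_set this).trans ((lintegral_union_le _ _ _).trans ?_)
      gcongr
      calc ∫⁻ x in B \ K, ENNReal.ofReal |(f : X → ℝ) x| ∂ν
          ≤ ∫⁻ _ in B \ K, ENNReal.ofReal C ∂ν :=
            lintegral_mono fun x => ENNReal.ofReal_le_ofReal (hC x)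
        _ = ENNReal.ofReal C * ν (B \ K) := by simp
        _ ≤ _ := by gcongr
    have lim : Tendsto (fun n : ℕ => c *
        ((∫⁻ x, ENNReal.ofReal |(f : X → ℝ) x| ∂(μ.restrict B + ν.restrict Bᶜ)) +
          ENNReal.ofReal C * ((1 / ((n : NNReal) + 1) : NNReal) : ENNReal))) atTop
        (𝓝 (c * ((∫⁻ x, ENNReal.ofReal |(f : X → ℝ) x| ∂(μ.restrict B + ν.restrict Bᶜ)) +
          ENNReal.ofReal C * ((0 : NNReal) : ENNReal)))) := by
      refine ENNReal.Tendsto.const_mul (tendsto_const_nhds.add (ENNReal.Tendsto.const_mul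
        (ENNReal.tendsto_coe.2 tendsto_one_div_add_atTop_nhds_zero_nat)
        (Or.inr ENNReal.ofReal_ne_top))) (Or.inr ENNReal.ofReal_ne_top)
    have := ge_of_tendsto' lim fun n => key _ (by positivity)
    simpa using this
  · refine Measure.le_iff.2 fun s hs => ?_
    rw [Measure.add_apply, Measure.restrict_apply hs, Measure.restrict_apply hs]
    calc μ (s ∩ B) + ν (s ∩ Bᶜ) ≤ μ (s ∩ B) + μ (s ∩ Bᶜ) :=
          add_le_add le_rfl (h2 _ (hs.inter hB.compl) Set.inter_subset_right)
      _ = μ s := by rw [← Set.sdiff_eq]; exact measure_inter_add_sdiff s hB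
  · refine Measure.le_iff.2 fun s hs => ?_
    rw [Measure.add_apply, Measure.restrict_apply hs, Measure.restrict_apply hs]
    calc μ (s ∩ B) + ν (s ∩ Bᶜ) ≤ ν (s ∩ B) + ν (s ∩ Bᶜ) :=
          add_le_add (h1 _ (hs.inter hB) Set.inter_subset_right) le_rfl
      _ = ν s := by rw [← Set.sdiff_eq]; exact measure_inter_add_sdiff s hB

/-- A decreasing sequence of mass bounds has a lower bound that is a mass bound. -/
theorem IsMassBound.exists_le_seq {T : Functional X k} {ρ : ℕ → Measure X}
    (hρ : ∀ n, IsMassBound T (ρ n)) (hanti : Antitone ρ) :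
    ∃ μ, IsMassBound T μ ∧ ∀ n, μ ≤ ρ n := by
  have hfin : ∀ n, IsFiniteMeasure (ρ n) := fun n => (hρ n).1
  let g : ℕ → X → ENNReal := fun n => (ρ n).rnDeriv (ρ 0)
  have hg : ∀ n, Measurable (g n) := fun n => Measure.measurable_rnDeriv _ _
  have hw : ∀ n, (ρ 0).withDensity (g n) = ρ n := fun n =>
    Measure.withDensity_rnDeriv_eq _ _
      (Measure.absolutelyContinuous_of_le (hanti (Nat.zero_le n)))
  have hgm : ∀ n, g n.succ ≤ᵐ[ρ 0] g n := by
    intro n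
    refine ae_le_of_forall_setLIntegral_le_of_sigmaFinite (hg _) fun s hs _ => ?_
    rw [← withDensity_apply _ hs, ← withDensity_apply _ hs, hw, hw]
    exact hanti (Nat.le_succ n) s
  have hle : ∀ n, (ρ 0).withDensity (fun x => ⨅ n, g n x) ≤ ρ n := by
    intro n
    conv_rhs => rw [← hw n]
    exact withDensity_mono (Eventually.of_forall fun x => iInf_le _ n)
  refine ⟨(ρ 0).withDensity (fun x => ⨅ n, g n x), ?_, hle⟩
  refine (isMassBound_iff _ _).2 ⟨isFiniteMeasure_of_le (ρ 0) (hle 0), fun f π => ?_⟩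
  have hf : Measurable fun x => ENNReal.ofReal |(f : X → ℝ) x| :=
    (measurable_lipB f).abs.ennreal_ofReal
  have hfn : ∀ n, ∫⁻ x, ENNReal.ofReal |(f : X → ℝ) x| ∂(ρ n) =
      ∫⁻ x, g n x * ENNReal.ofReal |(f : X → ℝ) x| ∂(ρ 0) := by
    intro n
    conv_lhs => rw [← hw n]
    exact lintegral_withDensity_eq_lintegral_mul _ (hg n) hf
  rw [lintegral_withDensity_eq_lintegral_mul _ (Measurable.iInf hg) hf]
  have e : ∀ x, ((fun x => ⨅ n, g n x) * fun x => ENNReal.ofReal |(f : X → ℝ) x|) x =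
      ⨅ n, g n x * ENNReal.ofReal |(f : X → ℝ) x| := by
    intro x
    exact ENNReal.iInf_mul' (fun h => absurd h ENNReal.ofReal_ne_top) (fun _ => inferInstance)
  simp_rw [e]
  rw [lintegral_iInf_ae (f := fun n x => g n x * ENNReal.ofReal |(f : X → ℝ) x|)
    (fun n => (hg n).mul hf) (fun n => ?_) ?_]
  · simp_rw [← hfn]
    rw [ENNReal.mul_iInf' (fun h => absurd h ENNReal.ofReal_ne_top) (fun _ => inferInstance)]
    exact le_iInf fun n => ((isMassBound_iff _ _).1 (hρ n)).2 f π
  · rw [← hfn]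
    exact lintegral_lipB_ne_top f _
  · filter_upwards [hgm n] with x hx
    gcongr

/-- The mass measure of a functional of finite mass is the least measure satisfying the finite
mass condition. -/
theorem massMeasure_isLeast {T : Functional X k} (hT : ∃ μ, IsMassBound T μ) :
    IsLeast {μ | IsMassBound T μ} (massMeasure T) := by
  suffices h : ∃ μ, IsLeast {μ | IsMassBound T μ} μ by
    obtain ⟨μ, hμ⟩ := h
    have : massMeasure T = μ := hμ.isGLB.sInf_eq
    rwa [this]
  let M : Set ENNReal := (fun μ : Measure X => μ Set.univ) '' {μ | IsMassBound T μ}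
  have hM : M.Nonempty := Set.Nonempty.image _ hT
  obtain ⟨u, -, hu, huM⟩ := exists_seq_tendsto_sInf hM (OrderBot.bddBelow M)
  choose v hv hvu using huM
  have hglue : ∀ a b : {μ : Measure X // IsMassBound T μ}, ∃ c : {μ : Measure X // IsMassBound T μ},
      c.1 ≤ a.1 ∧ c.1 ≤ b.1 := fun a b => by
    obtain ⟨ρ, h1, h2, h3⟩ := a.2.exists_le b.2
    exact ⟨⟨ρ, h1⟩, h2, h3⟩
  choose G hG1 hG2 using hglue
  let ρ : ℕ → {μ : Measure X // IsMassBound T μ} := fun n =>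
    Nat.rec ⟨v 0, hv 0⟩ (fun m p => G p ⟨v (m + 1), hv (m + 1)⟩) n
  have hanti : Antitone fun n => (ρ n).1 := antitone_nat_of_succ_le fun n => hG1 _ _
  have hρv : ∀ n, (ρ n).1 ≤ v n := by
    intro n
    cases n with
    | zero => exact le_rfl
    | succ m => exact hG2 _ _
  obtain ⟨μ, hμ, hle⟩ := IsMassBound.exists_le_seq (fun n => (ρ n).2) hanti
  refine ⟨μ, hμ, fun ν hν => ?_⟩
  obtain ⟨σ, hσ, h1, h2⟩ := hμ.exists_le hν
  have := hσ.1
  have hσμ : σ = μ := by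
    refine Measure.eq_of_le_of_measure_univ_eq h1 (le_antisymm (h1 _) ?_)
    refine le_trans ?_ (sInf_le (show σ Set.univ ∈ M from ⟨σ, hσ, rfl⟩))
    refine ge_of_tendsto' hu fun n => ?_
    rw [← hvu n]
    exact ((hle n).trans (hρv n)) _
  exact hσμ ▸ h2

end Minimality

end MetricCurrents

namespace MetricCurrents

/-! ### Lipschitz constants and truncation -/

section LipschitzConstant

variable {X : Type*} [MetricSpace X]

/-! The strategy is to correct `T` by currents of small mass until its boundary is a finite
combination of Dirac masses. The boundary is viewed as the linear functional `u ↦ T (1, u)` on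
Lipschitz functions, measured against `lipConst`.

Up to a small mass, `T` lives on a compact set `K`. A 1-Lipschitz `u` vanishing on a fine finite net
of `K` is uniformly small on `K`; joint continuity controls its truncation, and locality bounds the
rest by the mass outside `K`. So the boundary is almost determined by finitely many points
(`IsMetricCurrent.finitelyDetermined_boundaryForm`).

By Hahn–Banach, such a functional of norm at most `η` is, up to arbitrarily small error, a finite
combination of molecules `(δ_x - δ_y) / d(x, y)` of total weight at most `η`
(`FinitelyDetermined.exists_molecule`). Quasiconvexity fills each molecule by a curve of mass at
most `L`, giving a current of mass at most `L * η`.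

Iterating on the remainder with geometrically decreasing errors yields currents `G k` of summable
mass whose boundaries add up to that of `T` (`IsQuasiconvex.exists_seq_currents`). Subtracting from
`T` the tail of the series from index `n` on leaves the boundary of `G 0 + ⋯ + G (n - 1)`, a finite
combination of Dirac masses, so the result is normal; its distance to `T` is the mass of the tail.
The full series need not equal `T`; only the boundaries agree. -/

theorem lipConst_le_of_forall {g : X → ℝ} {K : ℝ} (hK : 0 ≤ K)
    (h : ∀ x y, |g x - g y| ≤ K * dist x y) : lipConst g ≤ K :=
  Real.iSup_le (fun p => div_le_of_le_mul₀ dist_nonneg hK (h p.1 p.2)) hK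

theorem abs_sub_le_lipConst (u : Lip X) (x y : X) :
    |(u : X → ℝ) x - (u : X → ℝ) y| ≤ lipConst (u : X → ℝ) * dist x y := by
  rcases eq_or_ne x y with rfl | hxy
  · simp
  obtain ⟨K, hK⟩ := u.2
  rw [← div_le_iff₀ (dist_pos.2 hxy)]
  refine le_ciSup (f := fun p : X × X => |(u : X → ℝ) p.1 - (u : X → ℝ) p.2| / dist p.1 p.2)
    ⟨K, ?_⟩ (x, y)
  rintro _ ⟨p, rfl⟩
  refine div_le_of_le_mul₀ dist_nonneg K.2 ?_
  have := hK.dist_le_mul p.1 p.2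
  rwa [Real.dist_eq] at this

theorem lipschitzWith_lipConst (u : Lip X) :
    LipschitzWith (lipConst (u : X → ℝ)).toNNReal (u : X → ℝ) :=
  LipschitzWith.of_dist_le_mul fun x y => by
    rw [Real.coe_toNNReal _ (lipConst_nonneg _), Real.dist_eq]
    exact abs_sub_le_lipConst u x y

theorem continuous_lip (u : Lip X) : Continuous (u : X → ℝ) :=
  (lipschitzWith_lipConst u).continuous

theorem lipConst_le_of_lipschitzWith {g : X → ℝ} {K : NNReal} (h : LipschitzWith K g) :
    lipConst g ≤ K :=
  lipConst_le_of_forall K.2 fun x y => by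
    have := h.dist_le_mul x y
    rwa [Real.dist_eq] at this

theorem lipConst_add_le (u v : Lip X) :
    lipConst ((u + v : Lip X) : X → ℝ) ≤ lipConst (u : X → ℝ) + lipConst (v : X → ℝ) := by
  refine lipConst_le_of_forall (add_nonneg (lipConst_nonneg _) (lipConst_nonneg _)) fun x y => ?_
  have h1 := abs_sub_le_lipConst u x y
  have h2 := abs_sub_le_lipConst v x y
  calc |((u : X → ℝ) x + (v : X → ℝ) x) - ((u : X → ℝ) y + (v : X → ℝ) y)|
      = |((u : X → ℝ) x - (u : X → ℝ) y) + ((v : X → ℝ) x - (v : X → ℝ) y)| := by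
        congr 1; ring
    _ ≤ _ := (abs_add_le _ _).trans (by linarith)

theorem lipConst_smul_le (c : ℝ) (u : Lip X) :
    lipConst ((c • u : Lip X) : X → ℝ) ≤ |c| * lipConst (u : X → ℝ) := by
  refine lipConst_le_of_forall (mul_nonneg (abs_nonneg _) (lipConst_nonneg _)) fun x y => ?_
  calc |c * (u : X → ℝ) x - c * (u : X → ℝ) y| = |c| * |(u : X → ℝ) x - (u : X → ℝ) y| := by
        rw [← mul_sub, abs_mul]
    _ ≤ _ := by
        rw [mul_assoc]
        exact mul_le_mul_of_nonneg_left (abs_sub_le_lipConst u x y) (abs_nonneg c)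

theorem lipConst_smul (c : ℝ) (u : Lip X) :
    lipConst ((c • u : Lip X) : X → ℝ) = |c| * lipConst (u : X → ℝ) := by
  refine le_antisymm (lipConst_smul_le c u) ?_
  rcases eq_or_ne c 0 with rfl | hc
  · simpa using lipConst_nonneg _
  · have := lipConst_smul_le c⁻¹ (c • u)
    rw [inv_smul_smul₀ hc, abs_inv] at this
    rwa [← le_inv_mul_iff₀ (abs_pos.2 hc)]

theorem lipConst_sub_le (u v : Lip X) :
    lipConst ((u - v : Lip X) : X → ℝ) ≤ lipConst (u : X → ℝ) + lipConst (v : X → ℝ) := by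
  have h := lipConst_add_le u ((-1 : ℝ) • v)
  rw [lipConst_smul] at h
  simpa [sub_eq_add_neg] using h

/-- Postcomposition of a Lipschitz function with a `1`-Lipschitz function of one variable. -/
def Lip.postcomp (r : ℝ → ℝ) (hr : LipschitzWith 1 r) (u : Lip X) : Lip X :=
  ⟨fun x => r ((u : X → ℝ) x), _, hr.comp (lipschitzWith_lipConst u)⟩

theorem lipConst_postcomp_le (r : ℝ → ℝ) (hr : LipschitzWith 1 r) (u : Lip X) :
    lipConst (Lip.postcomp r hr u : X → ℝ) ≤ lipConst (u : X → ℝ) := by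
  refine lipConst_le_of_forall (lipConst_nonneg _) fun x y => ?_
  refine le_trans ?_ (abs_sub_le_lipConst u x y)
  have h := hr.dist_le_mul ((u : X → ℝ) x) ((u : X → ℝ) y)
  rw [NNReal.coe_one, one_mul] at h
  exact h

/-- Truncation of a real number to `[-δ, δ]`. -/
def truncate (δ t : ℝ) : ℝ := max (-δ) (min t δ)

theorem lipschitzWith_truncate (δ : ℝ) : LipschitzWith 1 (truncate δ) :=
  (LipschitzWith.id.min_const δ).const_max (-δ)

/-- Composition with this map makes a function vanish on a neighbourhood of its zero set without
increasing its Lipschitz constant, as locality requires. -/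
theorem lipschitzWith_sub_truncate {δ : ℝ} (hδ : 0 ≤ δ) :
    LipschitzWith 1 fun t => t - truncate δ t := by
  refine LipschitzWith.of_dist_le_mul fun s t => ?_
  simp only [truncate, Real.dist_eq, NNReal.coe_one, one_mul]
  rcases abs_cases (s - t) with ⟨h, _⟩ | ⟨h, _⟩ <;> rw [h, abs_le] <;> constructor <;>
    grind

theorem truncate_eq_self {δ t : ℝ} (h : |t| ≤ δ) : truncate δ t = t := by
  rw [abs_le] at h
  simp [truncate, h.1, h.2]

theorem abs_truncate_le {δ : ℝ} (hδ : 0 ≤ δ) (t : ℝ) : |truncate δ t| ≤ δ := by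
  rw [abs_le]
  exact ⟨le_max_left _ _, max_le (by linarith) (min_le_right _ _)⟩

end LipschitzConstant

/-! ### The boundary as a functional on Lipschitz functions -/

section OneForms

variable {X : Type*} [MetricSpace X]

/-- The functional `u ↦ T (1, u)`, which is the boundary of `T` on all Lipschitz functions. -/
noncomputable def boundaryForm (T : Functional X 1) : Lip X →ₗ[ℝ] ℝ :=
  (MultilinearMap.ofSubsingleton ℝ (Lip X) ℝ (0 : Fin 1)).symm (T (oneLipB X))

theorem boundaryForm_apply (T : Functional X 1) (u : Lip X) :
    boundaryForm T u = T (oneLipB X) fun _ => u := rfl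

theorem boundaryForm_sub (T S : Functional X 1) (u : Lip X) :
    boundaryForm (T - S) u = boundaryForm T u - boundaryForm S u := rfl

/-- A linear functional on Lipschitz functions is finitely determined if it is small on Lipschitz
functions vanishing on large finite sets. -/
def FinitelyDetermined (τ : Lip X →ₗ[ℝ] ℝ) : Prop :=
  ∀ ε > 0, ∃ F : Finset X, ∀ u : Lip X, (∀ x ∈ F, (u : X → ℝ) x = 0) →
    |τ u| ≤ ε * lipConst (u : X → ℝ)

theorem FinitelyDetermined.sub {τ σ : Lip X →ₗ[ℝ] ℝ} (hτ : FinitelyDetermined τ)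
    (hσ : FinitelyDetermined σ) : FinitelyDetermined (τ - σ) := by
  classical
  intro ε hε
  obtain ⟨F, hF⟩ := hτ (ε / 2) (half_pos hε)
  obtain ⟨F', hF'⟩ := hσ (ε / 2) (half_pos hε)
  refine ⟨F ∪ F', fun u hu => ?_⟩
  have h1 := hF u fun x hx => hu x (Finset.mem_union_left _ hx)
  have h2 := hF' u fun x hx => hu x (Finset.mem_union_right _ hx)
  exact (abs_sub _ _).trans (by linarith)

variable [MeasurableSpace X]

theorem IsMassBound.abs_apply_le {T : Functional X 1} {μ : Measure X} (hμ : IsMassBound T μ)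
    (f : LipB X) (u : Lip X) :
    |T f fun _ => u| ≤ lipConst (u : X → ℝ) * ∫ x, |(f : X → ℝ) x| ∂μ := by
  simpa using hμ.2 f fun _ => u

/-- If no `δ` worked, one would get 1-Lipschitz functions tending uniformly to `0` with boundary
values bounded away from `0`, against joint continuity. -/
theorem IsMetricCurrent.exists_forall_abs_boundaryForm_le {T : Functional X 1}
    (hT : IsMetricCurrent T) {ε : ℝ} (hε : 0 < ε) :
    ∃ δ > 0, ∀ u : Lip X, lipConst (u : X → ℝ) ≤ 1 → (∀ x, |(u : X → ℝ) x| ≤ δ) →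
      |boundaryForm T u| ≤ ε := by
  by_contra! h
  choose u hu1 hu2 hu3 using fun n : ℕ => h (1 / ((n : ℝ) + 1)) (by positivity)
  have hlim : Tendsto (fun n => boundaryForm T (u n)) atTop (𝓝 (boundaryForm T 0)) :=
    hT.joint_continuity (oneLipB X) (fun _ => 0) (fun n _ => u n) ⟨1, fun n _ => hu1 n⟩
      fun _ x => squeeze_zero_norm (fun n => hu2 n x) tendsto_one_div_add_atTop_nhds_zero_nat
  rw [map_zero] at hlim
  have := ge_of_tendsto' hlim.abs fun n => (hu3 n).le
  rw [abs_zero] at this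
  linarith

theorem IsMassBound.abs_boundaryForm_le {T : Functional X 1} {μ : Measure X}
    (hμ : IsMassBound T μ) (u : Lip X) :
    |boundaryForm T u| ≤ μ.real Set.univ * lipConst (u : X → ℝ) := by
  refine (hμ.abs_apply_le (oneLipB X) u).trans (le_of_eq ?_)
  simp [oneLipB, mul_comm]

variable [BorelSpace X]

/-- The boundary of a `1`-current sees a Lipschitz function vanishing on `K` only through the mass
outside of `K`. -/
theorem IsMetricCurrent.abs_boundaryForm_le_of_eqOn_zero {T : Functional X 1}
    (hT : IsMetricCurrent T) {μ : Measure X} (hμ : IsMassBound T μ) {K : Set X}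
    (hK : MeasurableSet K) (u : Lip X) (hu : ∀ x ∈ K, (u : X → ℝ) x = 0) :
    |boundaryForm T u| ≤ lipConst (u : X → ℝ) * μ.real Kᶜ := by
  have := hμ.1
  have hδ : ∀ n : ℕ, (0 : ℝ) < 1 / ((n : ℝ) + 1) := fun n => by positivity
  -- Locality needs vanishing near `K`, not just on `K`: `v n` is `0` wherever `|u| ≤ 1 / (n + 1)`.
  let v : ℕ → Lip X := fun n => Lip.postcomp _ (lipschitzWith_sub_truncate (hδ n).le) u
  have hv : ∀ n x, (v n : X → ℝ) x =
    (u : X → ℝ) x - truncate (1 / ((n : ℝ) + 1)) ((u : X → ℝ) x) := fun _ _ => rfl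
  have hvL : ∀ n, lipConst (v n : X → ℝ) ≤ lipConst (u : X → ℝ) := fun n =>
    lipConst_postcomp_le _ _ u
  have hlim : Tendsto (fun n => boundaryForm T (v n)) atTop (𝓝 (boundaryForm T u)) := by
    refine hT.joint_continuity (oneLipB X) (fun _ => u) (fun n _ => v n)
      ⟨_, fun n _ => hvL n⟩ fun _ x => ?_
    have h0 : Tendsto (fun n : ℕ => truncate (1 / ((n : ℝ) + 1)) ((u : X → ℝ) x)) atTop (𝓝 0) :=
      squeeze_zero_norm (fun n => abs_truncate_le (hδ n).le _)
        tendsto_one_div_add_atTop_nhds_zero_nat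
    simpa [hv] using h0.const_sub ((u : X → ℝ) x)
  refine le_of_tendsto' hlim.abs fun n => ?_
  set δ : ℝ := 1 / ((n : ℝ) + 1) with hδdef
  -- This cutoff is `1` on `K` and nonzero only where `|u| < δ`, a region on which `v n` is zero.
  -- Replacing `1` by `1 - φ` therefore does not change the value, and `1 - φ` is at most the
  -- indicator of `Kᶜ`.
  let φ : LipB X := ⟨fun x => max 0 (1 - δ⁻¹ * |(u : X → ℝ) x|), by
    have h1 : LipschitzWith _ fun x => 1 - δ⁻¹ * |(u : X → ℝ) x| :=
      (LipschitzWith.const (1 : ℝ)).sub ((lipschitzWith_smul δ⁻¹).comp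
        (lipschitzWith_one_norm.comp (lipschitzWith_lipConst u)))
    refine ⟨⟨_, h1.const_max 0⟩, 1, fun x => ?_⟩
    have : 0 ≤ δ⁻¹ * |(u : X → ℝ) x| := mul_nonneg (inv_nonneg.2 (hδ n).le) (abs_nonneg _)
    rw [abs_of_nonneg (le_max_left _ _)]
    exact max_le zero_le_one (by linarith)⟩
  have hφ0 : T φ (fun _ => v n) = 0 := by
    refine hT.locality φ _ ⟨0, {x | |(u : X → ℝ) x| < δ}, ?_, 0, fun x hx => ?_⟩
    · refine (isOpen_lt (continuous_lip u).abs continuous_const).mem_nhdsSet.2 fun x hx => ?_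
      by_contra hx'
      refine hx (max_eq_left ?_)
      rw [Set.mem_ofPred_eq, not_lt] at hx'
      rw [sub_nonpos, inv_mul_eq_div, one_le_div (hδ n)]
      exact hx'
    · rw [hv, truncate_eq_self (le_of_lt hx), sub_self]
  have hsplit : boundaryForm T (v n) = T (oneLipB X - φ) fun _ => v n := by
    rw [map_sub, sub_apply, hφ0, sub_zero, boundaryForm_apply]
  rw [hsplit]
  refine (hμ.abs_apply_le _ _).trans ?_
  refine mul_le_mul (hvL n) ?_ (integral_nonneg fun _ => abs_nonneg _) (lipConst_nonneg _)
  have hind : ∫ x, Kᶜ.indicator (fun _ => (1 : ℝ)) x ∂μ = μ.real Kᶜ := by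
    rw [integral_indicator hK.compl]; simp
  rw [← hind]
  refine integral_mono (integrable_lipB _ μ) ((integrable_const 1).indicator hK.compl) fun x => ?_
  change |1 - max 0 (1 - δ⁻¹ * |(u : X → ℝ) x|)| ≤ _
  by_cases hx : x ∈ K
  · simp [hx, hu x hx]
  · have : 0 ≤ δ⁻¹ * |(u : X → ℝ) x| := mul_nonneg (inv_nonneg.2 (hδ n).le) (abs_nonneg _)
    rw [Set.indicator_of_mem hx, abs_of_nonneg]
    · linarith [le_max_left 0 (1 - δ⁻¹ * |(u : X → ℝ) x|)]
    · exact sub_nonneg.2 (max_le zero_le_one (by linarith))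

/-- The boundary of a `1`-current with inner regular mass is finitely determined. -/
theorem IsMetricCurrent.finitelyDetermined_boundaryForm {T : Functional X 1}
    (hT : IsMetricCurrent T) {μ : Measure X} (hμ : IsMassBound T μ) (hreg : μ.InnerRegular) :
    FinitelyDetermined (boundaryForm T) := by
  intro ε hε
  have := hμ.1
  -- The error splits as `ε / 2` for the truncation of `u` and `2 * (ε / 4)` for the rest, whose
  -- Lipschitz constant is at most `2`.
  obtain ⟨K, -, hKc, hKμ⟩ : ∃ K ⊆ Set.univ, IsCompact K ∧ μ (Set.univ \ K) <
      ENNReal.ofReal (ε / 4) :=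
    MeasurableSet.univ.exists_isCompact_sdiff_lt (measure_ne_top _ _) (by simpa using hε)
  rw [← Set.compl_eq_univ_sdiff] at hKμ
  have hKμ' : μ.real Kᶜ ≤ ε / 4 :=
    ENNReal.toReal_le_of_le_ofReal (by positivity) hKμ.le
  obtain ⟨δ, hδ, hcont⟩ := hT.exists_forall_abs_boundaryForm_le (half_pos hε)
  obtain ⟨F, hFK, hFfin, hF⟩ := hKc.finite_cover_balls hδ
  have main : ∀ u : Lip X, lipConst (u : X → ℝ) ≤ 1 → (∀ x ∈ F, (u : X → ℝ) x = 0) →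
      |boundaryForm T u| ≤ ε := by
    intro u hu hu0
    let w := Lip.postcomp _ (lipschitzWith_truncate δ) u
    have hw : |boundaryForm T w| ≤ ε / 2 :=
      hcont w ((lipConst_postcomp_le _ _ u).trans hu) fun x => abs_truncate_le hδ.le _
    have hz : |boundaryForm T (u - w)| ≤ lipConst ((u - w : Lip X) : X → ℝ) * μ.real Kᶜ := by
      refine hT.abs_boundaryForm_le_of_eqOn_zero hμ hKc.measurableSet _ fun x hx => ?_
      -- Each point of `K` is within `δ` of a zero of the 1-Lipschitz function `u`, so truncation at
      -- `δ` leaves `u` unchanged on `K`.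
      obtain ⟨y, hy, hxy⟩ := Set.mem_iUnion₂.1 (hF hx)
      have h1 := abs_sub_le_lipConst u x y
      rw [hu0 y hy, sub_zero] at h1
      have h2 : |(u : X → ℝ) x| ≤ δ := h1.trans
        ((mul_le_of_le_one_left dist_nonneg hu).trans (le_of_lt hxy))
      exact sub_eq_zero.2 (truncate_eq_self h2).symm
    have h3 : lipConst ((u - w : Lip X) : X → ℝ) ≤ 2 := by
      linarith [lipConst_sub_le u w, lipConst_postcomp_le _ (lipschitzWith_truncate δ) u]
    have h4 : lipConst ((u - w : Lip X) : X → ℝ) * μ.real Kᶜ ≤ 2 * (ε / 4) :=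
      mul_le_mul h3 hKμ' measureReal_nonneg zero_le_two
    have h5 : boundaryForm T u = boundaryForm T w + boundaryForm T (u - w) := by
      rw [← map_add, add_sub_cancel]
    rw [h5]
    exact (abs_add_le _ _).trans (by linarith)
  refine ⟨hFfin.toFinset, fun u hu => ?_⟩
  rcases (lipConst_nonneg (u : X → ℝ)).eq_or_lt with h0 | hpos
  · have := hμ.abs_boundaryForm_le u
    rw [← h0, mul_zero] at this ⊢
    exact this
  · have h1 := main ((lipConst (u : X → ℝ))⁻¹ • u) (by
      rw [lipConst_smul, abs_inv, abs_of_pos hpos, inv_mul_cancel₀ hpos.ne']) (fun x hx => by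
      simp [hu x (hFfin.mem_toFinset.2 hx)])
    rw [map_smul, smul_eq_mul, abs_mul, abs_inv, abs_of_pos hpos, inv_mul_le_iff₀ hpos] at h1
    linarith

end OneForms

/-! ### Lipschitz reparametrization of rectifiable curves -/

section Curves

variable {X : Type*} [MetricSpace X]

/-- A continuous curve of finite length has a Lipschitz reparametrization. -/
theorem exists_lipschitzWith_of_path {x y : X} (γ : Path x y) {l : NNReal}
    (hγ : eVariationOn γ Set.univ ≤ l) :
    ∃ g : ℝ → X, LipschitzWith l g ∧ g 0 = x ∧ g 1 = y := by
  have hbv : BoundedVariationOn γ Set.univ := ne_top_of_le_ne_top ENNReal.coe_ne_top hγ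
  have hfin : ∀ s t, eVariationOn γ (Set.Icc s t) ≠ ⊤ := fun s t =>
    hbv.mono (Set.subset_univ _)
  let v : unitInterval → ℝ := fun t => (eVariationOn γ (Set.Icc 0 t)).toReal
  have hadd : ∀ s t, s ≤ t → v s + (eVariationOn γ (Set.Icc s t)).toReal = v t := by
    intro s t hst
    have h := eVariationOn.Icc_add_Icc γ (s := Set.univ) (a := 0) (b := s) (c := t)
      unitInterval.nonneg' hst (Set.mem_univ s)
    simp only [Set.univ_inter] at h
    rw [← ENNReal.toReal_add (hfin _ _) (hfin _ _), h]
  have hdist : ∀ s t, dist (γ s) (γ t) ≤ |v s - v t| := by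
    intro s t
    wlog hst : s ≤ t generalizing s t
    · rw [dist_comm, abs_sub_comm]
      exact this t s (le_of_not_ge hst)
    have h := BoundedVariationOn.dist_le (hfin s t) (Set.left_mem_Icc.2 hst)
      (Set.right_mem_Icc.2 hst)
    rw [abs_sub_comm]
    refine h.trans (le_trans (le_of_eq ?_) (le_abs_self _))
    linarith [hadd s t hst]
  have hvc : Continuous v := by
    refine continuous_iff_continuousAt.2 fun t => ?_
    have hl : Tendsto (fun s => (eVariationOn γ (Set.Icc s t)).toReal) (𝓝 t) (𝓝 0) := by
      have := hbv.tendsto_eVariationOn_Ico_zero t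
      simp only [Set.univ_inter, nhdsWithin_univ] at this
      simp only [eVariationOn.eVariationOn_Ico_eq_Icc_of_continuousWithinAt
        γ.continuous.continuousWithinAt] at this
      exact (ENNReal.tendsto_toReal ENNReal.zero_ne_top).comp this
    have hr : Tendsto (fun s => (eVariationOn γ (Set.Icc t s)).toReal) (𝓝 t) (𝓝 0) := by
      have := hbv.tendsto_eVariationOn_Ioc_zero t
      simp only [Set.univ_inter, nhdsWithin_univ] at this
      simp only [eVariationOn.eVariationOn_Ioc_eq_Icc_of_continuousWithinAt
        γ.continuous.continuousWithinAt] at this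
      exact (ENNReal.tendsto_toReal ENNReal.zero_ne_top).comp this
    refine tendsto_iff_dist_tendsto_zero.2 (squeeze_zero (fun _ => dist_nonneg) (fun s => ?_)
      (by simpa using hl.add hr))
    rw [Real.dist_eq]
    rcases le_total s t with h | h
    · rw [abs_sub_comm, ← hadd s t h, add_sub_cancel_left, abs_of_nonneg ENNReal.toReal_nonneg]
      linarith [ENNReal.toReal_nonneg (a := eVariationOn γ (Set.Icc t s))]
    · rw [← hadd t s h, add_sub_cancel_left, abs_of_nonneg ENNReal.toReal_nonneg]
      linarith [ENNReal.toReal_nonneg (a := eVariationOn γ (Set.Icc s t))]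
  have hv0 : v 0 = 0 := by simp [v]
  have hv1 : v 1 ≤ l := ENNReal.toReal_le_coe_of_le_coe
    ((eVariationOn.mono _ (Set.subset_univ _)).trans hγ)
  have hv1' : 0 ≤ v 1 := ENNReal.toReal_nonneg
  have hsurj : ∀ r : unitInterval, ∃ t, v t = v 1 * r := by
    intro r
    have := intermediate_value_Icc (zero_le_one : (0 : unitInterval) ≤ 1) hvc.continuousOn
    rw [hv0] at this
    obtain ⟨t, -, ht⟩ := this ⟨mul_nonneg hv1' r.2.1, mul_le_of_le_one_right hv1' r.2.2⟩
    exact ⟨t, ht⟩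
  -- `σ` is an arbitrary, possibly discontinuous, right inverse of the normalized length. By
  -- `hdist`, points of equal length parameter have the same image, so `γ ∘ σ` is still Lipschitz
  -- and has the right endpoints.
  choose σ hσ using hsurj
  have hp := LipschitzWith.projIcc (zero_le_one : (0 : ℝ) ≤ 1)
  refine ⟨fun t => γ (σ (Set.projIcc 0 1 zero_le_one t)), ?_, ?_, ?_⟩
  · refine LipschitzWith.of_dist_le_mul fun s t => (hdist _ _).trans ?_
    rw [hσ, hσ, ← mul_sub, abs_mul, abs_of_nonneg hv1']
    refine mul_le_mul hv1 ?_ (abs_nonneg _) l.2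
    simpa only [Subtype.dist_eq, Real.dist_eq, NNReal.coe_one, one_mul] using hp.dist_le_mul s t
  · have h := hdist (σ 0) 0
    rw [hσ, hv0] at h
    have h' : γ (σ 0) = γ 0 := dist_le_zero.1 (by simpa using h)
    simpa using h'
  · have h := hdist (σ 1) 1
    rw [hσ] at h
    have h' : γ (σ 1) = γ 1 := dist_le_zero.1 (by simpa using h)
    simpa using h'

end Curves

/-! ### Integration along Lipschitz curves -/

section CurveCurrents

variable {X : Type*} [MetricSpace X]

theorem lipschitzWith_lip_comp {g : ℝ → X} {l : NNReal} (hg : LipschitzWith l g) (u : Lip X) :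
    LipschitzWith ((lipConst (u : X → ℝ)).toNNReal * l) fun t => (u : X → ℝ) (g t) :=
  (lipschitzWith_lipConst u).comp hg

theorem abs_deriv_lip_comp_le {g : ℝ → X} {l : NNReal} (hg : LipschitzWith l g) (u : Lip X)
    (t : ℝ) : |deriv (fun t => (u : X → ℝ) (g t)) t| ≤ lipConst (u : X → ℝ) * l := by
  have h := norm_deriv_le_of_lipschitz (lipschitzWith_lip_comp hg u) (x₀ := t)
  rwa [NNReal.coe_mul, Real.coe_toNNReal _ (lipConst_nonneg _)] at h

theorem intervalIntegrable_mul_deriv {g : ℝ → X} {l : NNReal} (hg : LipschitzWith l g)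
    (f : LipB X) (u : Lip X) : IntervalIntegrable
      (fun t => (f : X → ℝ) (g t) * deriv (fun t => (u : X → ℝ) (g t)) t) volume 0 1 :=
  ((lipschitzWith_lip_comp hg u).lipschitzOnWith.absolutelyContinuousOnInterval
    ).intervalIntegrable_deriv.continuousOn_mul
      (show Continuous fun t => (f : X → ℝ) (g t) from
        (continuous_lip (Submodule.inclusion (lipB_le_lip X) f)).comp hg.continuous).continuousOn

/-- The current of integration along a Lipschitz curve. -/
noncomputable def curveCurrent (g : ℝ → X) {l : NNReal} (hg : LipschitzWith l g) :
    Functional X 1 where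
  toFun f := MultilinearMap.ofSubsingleton ℝ (Lip X) ℝ (0 : Fin 1)
    { toFun u := ∫ t in (0 : ℝ)..1, (f : X → ℝ) (g t) * deriv (fun t => (u : X → ℝ) (g t)) t
      map_add' u v := by
        rw [← intervalIntegral.integral_add
          (intervalIntegrable_mul_deriv hg f u)
          (intervalIntegrable_mul_deriv hg f v)]
        refine intervalIntegral.integral_congr_ae ?_
        filter_upwards [(lipschitzWith_lip_comp hg u).ae_differentiableAt_real,
          (lipschitzWith_lip_comp hg v).ae_differentiableAt_real] with t hu hv _
        rw [← mul_add]
        congr 1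
        exact deriv_add hu hv
      map_smul' c u := by
        rw [RingHom.id_apply, smul_eq_mul, ← intervalIntegral.integral_const_mul]
        congr 1
        ext t
        rw [mul_left_comm]
        congr 1
        exact deriv_const_mul_field c }
  map_add' f f' := by
    ext π
    change ∫ t in (0 : ℝ)..1, ((f : X → ℝ) (g t) + (f' : X → ℝ) (g t)) * _ = _
    simp_rw [add_mul]
    exact intervalIntegral.integral_add
      (intervalIntegrable_mul_deriv hg f (π 0))
      (intervalIntegrable_mul_deriv hg f' (π 0))
  map_smul' c f := by
    ext π
    change ∫ t in (0 : ℝ)..1, (c * (f : X → ℝ) (g t)) * _ = _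
    simp_rw [mul_assoc]
    exact intervalIntegral.integral_const_mul c _

theorem curveCurrent_apply {g : ℝ → X} {l : NNReal} (hg : LipschitzWith l g) (f : LipB X)
    (π : Fin 1 → Lip X) : curveCurrent g hg f π =
      ∫ t in (0 : ℝ)..1, (f : X → ℝ) (g t) * deriv (fun t => (π 0 : X → ℝ) (g t)) t := rfl

/-- Integration by parts moves the derivative off `π`. Pointwise convergence of `π` says nothing
about derivatives, so joint continuity is read off from this form; `f = 1` gives the boundary. -/
theorem curveCurrent_eq_sub {g : ℝ → X} {l : NNReal} (hg : LipschitzWith l g) (f : LipB X)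
    (π : Fin 1 → Lip X) : curveCurrent g hg f π =
      (f : X → ℝ) (g 1) * (π 0 : X → ℝ) (g 1) - (f : X → ℝ) (g 0) * (π 0 : X → ℝ) (g 0) -
      ∫ t in (0 : ℝ)..1, deriv (fun t => (f : X → ℝ) (g t)) t * (π 0 : X → ℝ) (g t) :=
  AbsolutelyContinuousOnInterval.integral_mul_deriv_eq_deriv_mul
    (lipschitzWith_lip_comp hg
      (Submodule.inclusion (lipB_le_lip X) f)).lipschitzOnWith.absolutelyContinuousOnInterval
    (lipschitzWith_lip_comp hg (π 0)).lipschitzOnWith.absolutelyContinuousOnInterval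

theorem boundaryForm_curveCurrent {g : ℝ → X} {l : NNReal} (hg : LipschitzWith l g) (u : Lip X) :
    boundaryForm (curveCurrent g hg) u = (u : X → ℝ) (g 1) - (u : X → ℝ) (g 0) := by
  rw [boundaryForm_apply, curveCurrent_eq_sub]
  simp [oneLipB]

variable [MeasurableSpace X] [BorelSpace X]

theorem isMassBound_curveCurrent {g : ℝ → X} {l : NNReal} (hg : LipschitzWith l g) :
    IsMassBound (curveCurrent g hg) (l • (volume.restrict (Set.Ioc (0 : ℝ) 1)).map g) := by
  have hgm : Measurable g := hg.continuous.measurable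
  refine ⟨inferInstance, fun f π => ?_⟩
  have : IsFiniteMeasure ((volume.restrict (Set.Ioc (0 : ℝ) 1)).map g) := inferInstance
  rw [curveCurrent_apply, integral_smul_nnreal_measure, integral_map hgm.aemeasurable
    (measurable_lipB f).abs.aestronglyMeasurable, intervalIntegral.integral_of_le zero_le_one,
    Fin.prod_univ_one, NNReal.smul_def, smul_eq_mul, ← mul_assoc, ← integral_const_mul]
  refine abs_integral_le_integral_abs.trans (integral_mono_of_nonneg
    (Eventually.of_forall fun t => ?_) ?_ (Eventually.of_forall fun t => ?_))
  · exact abs_nonneg _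
  · exact ((integrable_lipB f _).comp_measurable hgm).const_mul _
  · simp only [abs_mul]
    rw [mul_comm]
    exact mul_le_mul_of_nonneg_right (abs_deriv_lip_comp_le hg _ t) (abs_nonneg _)

theorem curveCurrent_mass_univ {g : ℝ → X} (hg : Continuous g) (l : NNReal) :
    (l • (volume.restrict (Set.Ioc (0 : ℝ) 1)).map g) Set.univ = l := by
  rw [Measure.smul_apply, Measure.map_apply hg.measurable MeasurableSet.univ]
  simp [ENNReal.smul_def]

theorem isMetricCurrent_curveCurrent {g : ℝ → X} {l : NNReal} (hg : LipschitzWith l g) :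
    IsMetricCurrent (curveCurrent g hg) where
  locality := by
    rintro f π ⟨i, U, hU, c, hc⟩
    rw [Subsingleton.elim i 0] at hc
    rw [curveCurrent_apply]
    refine (intervalIntegral.integral_congr fun t _ => ?_).trans intervalIntegral.integral_zero
    by_cases ht : (f : X → ℝ) (g t) = 0
    · simp [ht]
    · have h1 : (fun s => (π 0 : X → ℝ) (g s)) =ᶠ[𝓝 t] fun _ => c := by
        filter_upwards [hg.continuous.continuousAt
          (nhds_le_nhdsSet (show g t ∈ {x | (f : X → ℝ) x ≠ 0} from ht) hU)] with s hs
        exact hc _ hs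
      simp [h1.deriv_eq]
  joint_continuity := by
    rintro f π πs ⟨L, hL⟩ hlim
    simp only [curveCurrent_eq_sub]
    refine (((hlim 0 _).const_mul _).sub ((hlim 0 _).const_mul _)).sub ?_
    have hL0 : 0 ≤ L := (lipConst_nonneg _).trans (hL 0 0)
    -- Convergence at the single point `g 0` bounds the values there; the common Lipschitz bound `L`
    -- propagates this to the dominating constant `B + L * l` along the curve.
    obtain ⟨B, hB⟩ := (hlim 0 (g 0)).bddAbove_range.union
      (hlim 0 (g 0)).neg.bddAbove_range
    set f' : Lip X := Submodule.inclusion (lipB_le_lip X) f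
    refine intervalIntegral.tendsto_integral_filter_of_dominated_convergence
      (fun _ => lipConst (f' : X → ℝ) * l * (B + L * l)) ?_ ?_ ?_ ?_
    · refine Eventually.of_forall fun n => ((measurable_deriv _).mul ?_).aestronglyMeasurable
      exact ((continuous_lip _).comp hg.continuous).measurable
    · refine Eventually.of_forall fun n => Eventually.of_forall fun t ht => ?_
      rw [Set.uIoc_of_le zero_le_one] at ht
      rw [norm_mul]
      refine mul_le_mul (abs_deriv_lip_comp_le hg f' t) ?_ (norm_nonneg _)
        (mul_nonneg (lipConst_nonneg _) l.2)
      have h1 : |(πs n 0 : X → ℝ) (g 0)| ≤ B := abs_le'.2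
        ⟨hB (Or.inl ⟨n, rfl⟩), hB (Or.inr ⟨n, rfl⟩)⟩
      have h2 := abs_sub_le_lipConst (πs n 0) (g t) (g 0)
      have h3 : lipConst (πs n 0 : X → ℝ) * dist (g t) (g 0) ≤ L * l := by
        refine mul_le_mul (hL n 0) ((hg.dist_le_mul t 0).trans ?_) dist_nonneg hL0
        rw [Real.dist_eq, sub_zero, abs_of_pos ht.1]
        exact mul_le_of_le_one_right l.2 ht.2
      have h4 : (πs n 0 : X → ℝ) (g t) = ((πs n 0 : X → ℝ) (g t) - (πs n 0 : X → ℝ) (g 0)) +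
        (πs n 0 : X → ℝ) (g 0) := by ring
      rw [Real.norm_eq_abs, h4]
      exact (abs_add_le _ _).trans (by linarith)
    · exact intervalIntegrable_const
    · exact Eventually.of_forall fun t _ => (hlim 0 _).const_mul _
  finite_mass := ⟨_, isMassBound_curveCurrent hg⟩

/-- In a quasiconvex space, the difference of two Dirac masses is the boundary of a current of mass
comparable to the distance. -/
theorem IsQuasiconvex.exists_current (hX : IsQuasiconvex X) :
    ∃ L : NNReal, ∀ x y : X, ∃ (G : Functional X 1) (ν : Measure X), IsMetricCurrent G ∧
      IsMassBound G ν ∧ ν Set.univ ≤ L * edist x y ∧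
      ∀ u : Lip X, boundaryForm G u = (u : X → ℝ) x - (u : X → ℝ) y := by
  obtain ⟨L, -, hL⟩ := hX
  refine ⟨L, fun x y => ?_⟩
  -- The curve runs from `y` to `x`, since the boundary is end minus start.
  obtain ⟨γ, hγ⟩ := hL y x
  have hγ' : eVariationOn γ Set.univ ≤ (L * nndist x y : NNReal) := by
    rwa [ENNReal.coe_mul, ← edist_nndist, edist_comm]
  obtain ⟨g, hg, h0, h1⟩ := exists_lipschitzWith_of_path γ hγ'
  refine ⟨curveCurrent g hg, _, isMetricCurrent_curveCurrent hg, isMassBound_curveCurrent hg, ?_,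
    fun u => ?_⟩
  · rw [curveCurrent_mass_univ hg.continuous, ENNReal.coe_mul, ← edist_nndist]
  · rw [boundaryForm_curveCurrent, h0, h1]

end CurveCurrents

/-! ### Approximation by molecules via Hahn–Banach -/

section Molecules

variable {X : Type*} [MetricSpace X]

/-- The difference quotients of a Lipschitz function on a finite set. -/
noncomputable def differenceQuotients (F : Finset X) : Lip X →ₗ[ℝ] (F × F → ℝ) where
  toFun u p := ((u : X → ℝ) p.1 - (u : X → ℝ) p.2) / dist (p.1 : X) p.2
  map_add' u v := by
    ext p
    change ((u : X → ℝ) p.1 + (v : X → ℝ) p.1 - ((u : X → ℝ) p.2 + (v : X → ℝ) p.2)) / _ =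
      _ / _ + _ / _
    ring
  map_smul' c u := by
    ext p
    change (c * (u : X → ℝ) p.1 - c * (u : X → ℝ) p.2) / _ = c * (_ / _)
    ring

/-- Restrict `u` to `F` and extend back to `w` with the Lipschitz constant of the restriction, which
is the sup of the difference quotients. Then `τ w` gives the first term, while `u - w` vanishes on
`F` and has constant at most `2 * lipConst u`, whence `ε / 2`. This is the domination needed for
Hahn–Banach. -/
theorem FinitelyDetermined.exists_forall_abs_le {τ : Lip X →ₗ[ℝ] ℝ} (hτ : FinitelyDetermined τ)
    {η : ℝ} (hη : 0 ≤ η) (hle : ∀ u : Lip X, |τ u| ≤ η * lipConst (u : X → ℝ)) {ε : ℝ}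
    (hε : 0 < ε) : ∃ F : Finset X, ∀ u : Lip X,
      |τ u| ≤ η * ‖differenceQuotients F u‖ + ε * lipConst (u : X → ℝ) := by
  obtain ⟨F, hF⟩ := hτ (ε / 2) (half_pos hε)
  refine ⟨F, fun u => ?_⟩
  set k := ‖differenceQuotients F u‖₊
  have hkq : ∀ p : F × F, |(u : X → ℝ) p.1 - (u : X → ℝ) p.2| / dist (p.1 : X) p.2 ≤ k := by
    intro p
    have h := norm_le_pi_norm (differenceQuotients F u) p
    rwa [Real.norm_eq_abs, differenceQuotients, LinearMap.coe_mk, AddHom.coe_mk, abs_div,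
      abs_of_nonneg dist_nonneg] at h
  have hLip : LipschitzOnWith k (u : X → ℝ) F := by
    refine LipschitzOnWith.of_dist_le_mul fun x hx y hy => ?_
    rcases eq_or_ne x y with rfl | hxy
    · simp
    · rw [← div_le_iff₀ (dist_pos.2 hxy)]
      exact hkq (⟨x, hx⟩, ⟨y, hy⟩)
  obtain ⟨v, hv, huv⟩ := hLip.extend_real
  let w : Lip X := ⟨v, k, hv⟩
  have hkL : (k : ℝ) ≤ lipConst (u : X → ℝ) := by
    refine (pi_norm_le_iff_of_nonneg (lipConst_nonneg _)).2 fun p => ?_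
    rw [Real.norm_eq_abs, differenceQuotients, LinearMap.coe_mk, AddHom.coe_mk, abs_div,
      abs_of_nonneg dist_nonneg]
    exact div_le_of_le_mul₀ dist_nonneg (lipConst_nonneg _) (abs_sub_le_lipConst u _ _)
  have hw : lipConst (w : X → ℝ) ≤ k := lipConst_le_of_lipschitzWith hv
  have h1 : |τ w| ≤ η * k := (hle w).trans (mul_le_mul_of_nonneg_left hw hη)
  have h2 : |τ (u - w)| ≤ ε / 2 * lipConst ((u - w : Lip X) : X → ℝ) :=
    hF _ fun x hx => sub_eq_zero.2 (huv hx)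
  have h3 : ε / 2 * lipConst ((u - w : Lip X) : X → ℝ) ≤ ε / 2 * (2 * lipConst (u : X → ℝ)) :=
    mul_le_mul_of_nonneg_left (by linarith [lipConst_sub_le u w]) (half_pos hε).le
  have h4 : τ u = τ w + τ (u - w) := by rw [← map_add, add_sub_cancel]
  rw [h4]
  refine (abs_add_le _ _).trans ?_
  change _ ≤ η * (k : ℝ) + _
  linarith

/-- A finitely determined functional of norm at most `η` is approximated by finite combinations of
molecules `(δ_x - δ_y) / d(x, y)` with total weight at most `η`. -/
theorem FinitelyDetermined.exists_molecule {τ : Lip X →ₗ[ℝ] ℝ} (hτ : FinitelyDetermined τ)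
    {η : ℝ} (hη : 0 ≤ η) (hle : ∀ u : Lip X, |τ u| ≤ η * lipConst (u : X → ℝ)) {ε : ℝ}
    (hε : 0 < ε) : ∃ (F : Finset X) (a : F × F → ℝ), ∑ p, |a p| ≤ η ∧
      ∀ u : Lip X, |τ u - ∑ p, a p * differenceQuotients F u p| ≤
        ε * lipConst (u : X → ℝ) := by
  classical
  obtain ⟨F, hF⟩ := hτ.exists_forall_abs_le hη hle hε
  refine ⟨F, ?_⟩
  -- `N` dominates `τ` on the graph of `differenceQuotients F`. An extension to the product splits
  -- `τ` into a functional of the difference quotients, of norm at most `η`, and an error bounded by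
  -- `ε * lipConst`.
  let N : (F × F → ℝ) × Lip X → ℝ := fun z => η * ‖z.1‖ + ε * lipConst (z.2 : X → ℝ)
  let j : Lip X →ₗ[ℝ] (F × F → ℝ) × Lip X := (differenceQuotients F).prod LinearMap.id
  obtain ⟨g, hgτ, hgN⟩ := exists_extension_of_le_sublinear
    ⟨LinearMap.range j, τ ∘ₗ LinearMap.snd ℝ _ _ ∘ₗ (LinearMap.range j).subtype⟩ N
    (fun c hc z => by
      simp only [N, Prod.smul_fst, Prod.smul_snd, norm_smul, lipConst_smul, Real.norm_eq_abs,
        abs_of_pos hc]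
      ring)
    (fun z w => by
      have h1 := mul_le_mul_of_nonneg_left (norm_add_le z.1 w.1) hη
      have h2 := mul_le_mul_of_nonneg_left (lipConst_add_le z.2 w.2) hε.le
      simp only [N, Prod.fst_add, Prod.snd_add]
      linarith)
    (by
      rintro ⟨_, u, rfl⟩
      exact (le_abs_self _).trans (hF u))
  have hgj : ∀ u, g (differenceQuotients F u, u) = τ u := fun u => hgτ ⟨j u, u, rfl⟩
  have hzero : lipConst ((0 : Lip X) : X → ℝ) = 0 := by
    have h := lipConst_smul 0 (0 : Lip X)
    simpa using h
  let α : (F × F → ℝ) →ₗ[ℝ] ℝ := g ∘ₗ LinearMap.inl ℝ _ _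
  have hα : ∀ q, α q ≤ η * ‖q‖ := fun q => by
    have h := hgN (q, 0)
    simp only [N, hzero, mul_zero, add_zero] at h
    exact h
  have hsum : ∀ q, α q = ∑ p, α (Pi.single p 1) * q p := fun q => by
    rw [LinearMap.pi_apply_eq_sum_univ α q]
    refine Finset.sum_congr rfl fun p _ => ?_
    rw [smul_eq_mul, mul_comm]
    congr 2
    ext i
    simp [Pi.single_apply, eq_comm]
  refine ⟨fun p => α (Pi.single p 1), ?_, fun u => ?_⟩
  -- The dual of the sup norm is the `ℓ¹` norm, attained on the sign vector.
  · let s : F × F → ℝ := fun p => SignType.sign (α (Pi.single p 1))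
    have h1 : ‖s‖ ≤ 1 := (pi_norm_le_iff_of_nonneg zero_le_one).2 fun p => by
      rw [Real.norm_eq_abs]
      rcases lt_trichotomy (α (Pi.single p 1)) 0 with h | h | h <;> simp [s, h]
    calc ∑ p, |α (Pi.single p 1)| = α s := by
          rw [hsum s]
          exact Finset.sum_congr rfl fun p _ => (self_mul_sign _).symm
      _ ≤ η * ‖s‖ := hα s
      _ ≤ η := mul_le_of_le_one_right hη h1
  · have hρ : ∀ v : Lip X, τ v - ∑ p, α (Pi.single p 1) * differenceQuotients F v p ≤
        ε * lipConst (v : X → ℝ) := fun v => by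
      have h := hgN (0, v)
      simp only [N, norm_zero, mul_zero, zero_add] at h
      refine le_trans (le_of_eq ?_) h
      rw [← hsum, ← hgj v, sub_eq_iff_eq_add]
      change _ = _ + g (_, 0)
      rw [← map_add]
      simp
    refine abs_le.2 ⟨?_, hρ u⟩
    have h := hρ (-u)
    have hn : lipConst ((-u : Lip X) : X → ℝ) = lipConst (u : X → ℝ) := by
      simpa using lipConst_smul (-1) u
    rw [hn] at h
    simp only [map_neg, Pi.neg_apply, mul_neg, Finset.sum_neg_distrib] at h
    linarith

end Molecules

/-! ### Linear combinations and series of currents -/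

section Series

variable {X : Type*} [MetricSpace X] [MeasurableSpace X] {k : ℕ}

theorem IsMassBound.smul {T : Functional X k} {μ : Measure X} (hμ : IsMassBound T μ) (c : ℝ) :
    IsMassBound (c • T) (‖c‖₊ • μ) := by
  have := hμ.1
  refine ⟨inferInstance, fun f π => ?_⟩
  rw [integral_smul_nnreal_measure, NNReal.smul_def, coe_nnnorm, Real.norm_eq_abs, smul_eq_mul,
    mul_left_comm]
  change |c * T f π| ≤ _
  rw [abs_mul]
  exact mul_le_mul_of_nonneg_left (hμ.2 f π) (abs_nonneg c)

theorem IsMetricCurrent.smul {T : Functional X k} (hT : IsMetricCurrent T) (c : ℝ) :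
    IsMetricCurrent (c • T) where
  locality f π h := by
    change c * T f π = 0
    rw [hT.locality f π h, mul_zero]
  joint_continuity f π πs h1 h2 := (hT.joint_continuity f π πs h1 h2).const_mul c
  finite_mass := hT.finite_mass.imp' (‖c‖₊ • ·) fun _ h => h.smul c

variable [BorelSpace X]

theorem IsMassBound.sub {T S : Functional X k} {μ ν : Measure X} (hμ : IsMassBound T μ)
    (hν : IsMassBound S ν) : IsMassBound (T - S) (μ + ν) := by
  have := hμ.1
  have := hν.1
  refine ⟨inferInstance, fun f π => ?_⟩
  rw [integral_add_measure (integrable_lipB f μ) (integrable_lipB f ν), mul_add]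
  exact (abs_sub _ _).trans (add_le_add (hμ.2 f π) (hν.2 f π))

theorem IsMetricCurrent.sub {T S : Functional X k} (hT : IsMetricCurrent T)
    (hS : IsMetricCurrent S) : IsMetricCurrent (T - S) where
  locality f π h := by
    change T f π - S f π = 0
    rw [hT.locality f π h, hS.locality f π h, sub_zero]
  joint_continuity f π πs h1 h2 :=
    (hT.joint_continuity f π πs h1 h2).sub (hS.joint_continuity f π πs h1 h2)
  finite_mass := by
    obtain ⟨μ, hμ⟩ := hT.finite_mass
    obtain ⟨ν, hν⟩ := hS.finite_mass
    exact ⟨_, hμ.sub hν⟩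

/-- A series of currents with summable masses converges to a current. -/
theorem exists_hasSum_current {ι : Type*} [Countable ι] {T : ι → Functional X k}
    {μ : ι → Measure X} (hT : ∀ i, IsMetricCurrent (T i)) (hμ : ∀ i, IsMassBound (T i) (μ i))
    (hfin : ∑' i, μ i Set.univ ≠ ⊤) :
    ∃ D : Functional X k, IsMetricCurrent D ∧ IsMassBound D (Measure.sum μ) ∧
      ∀ f π, HasSum (fun i => T i f π) (D f π) := by
  have hμfin := fun i => (hμ i).1
  have hmeas : IsFiniteMeasure (Measure.sum μ) := ⟨by
    rw [Measure.sum_apply _ MeasurableSet.univ]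
    exact hfin.lt_top⟩
  have hbound : ∀ (f : LipB X) (π : Fin k → Lip X) (L : ℝ), (∀ i, lipConst (π i : X → ℝ) ≤ L) →
      ∀ i, ‖T i f π‖ ≤ L ^ k * ∫ x, |(f : X → ℝ) x| ∂(μ i) := fun f π L hL i => by
    refine ((hμ i).2 f π).trans (mul_le_mul_of_nonneg_right ?_
      (integral_nonneg fun _ => abs_nonneg _))
    simpa using Finset.prod_le_prod (s := Finset.univ) (fun j _ => lipConst_nonneg (π j : X → ℝ))
      fun j _ => hL j
  have hint : ∀ f : LipB X, HasSum (fun i => ∫ x, |(f : X → ℝ) x| ∂(μ i))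
      (∫ x, |(f : X → ℝ) x| ∂(Measure.sum μ)) := fun f =>
    hasSum_integral_measure (integrable_lipB f _)
  have hsum : ∀ f π, Summable fun i => T i f π := fun f π => by
    refine Summable.of_norm_bounded
      (g := fun i => (∏ j, lipConst (π j : X → ℝ)) * ∫ x, |(f : X → ℝ) x| ∂(μ i))
      ((hint f).summable.mul_left _) fun i => (hμ i).2 f π
  let D : Functional X k :=
    { toFun f :=
        { toFun π := ∑' i, T i f π
          map_update_add' π j u v := by
            rw [← (hsum f _).tsum_add (hsum f _)]
            exact tsum_congr fun i => (T i f).map_update_add π j u v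
          map_update_smul' π j c u := by
            rw [smul_eq_mul, ← tsum_mul_left]
            exact tsum_congr fun i => (T i f).map_update_smul π j c u }
      map_add' f g := by
        ext π
        change ∑' i, T i (f + g) π = ∑' i, T i f π + ∑' i, T i g π
        rw [← (hsum f _).tsum_add (hsum g _)]
        exact tsum_congr fun i => by rw [map_add]; rfl
      map_smul' c f := by
        ext π
        change ∑' i, T i (c • f) π = c * ∑' i, T i f π
        rw [← tsum_mul_left]
        exact tsum_congr fun i => by rw [map_smul]; rfl }
  have hD : IsMassBound D (Measure.sum μ) :=
    ⟨hmeas, fun f π => tsum_of_norm_bounded (f := fun i => T i f π)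
      ((hint f).mul_left (∏ j, lipConst (π j : X → ℝ))) fun i => (hμ i).2 f π⟩
  refine ⟨D, ⟨fun f π h => ?_, ?_, _, hD⟩, hD, fun f π => (hsum f π).hasSum⟩
  · exact (tsum_congr fun i => (hT i).locality f π h).trans tsum_zero
  · rintro f π πs ⟨L, hL⟩ hlim
    -- The uniform Lipschitz bound `L` turns summability of the masses into a majorant independent
    -- of `n`.
    exact tendsto_tsum_of_dominated_convergence ((hint f).summable.mul_left (L ^ k))
      (fun i => (hT i).joint_continuity f π πs ⟨L, hL⟩ hlim)
      (Eventually.of_forall fun n => hbound f (πs n) L (hL n))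

end Series

/-! ### Boundaries that are finite combinations of Dirac masses -/

section FiniteBoundary

variable {X : Type*} [MetricSpace X]

/-- Evaluation of Lipschitz functions at a point. -/
def evalForm (x : X) : Lip X →ₗ[ℝ] ℝ := LinearMap.proj x ∘ₗ (Lip X).subtype

theorem exists_finset_of_mem_span_evalForm {τ : Lip X →ₗ[ℝ] ℝ}
    (hτ : τ ∈ Submodule.span ℝ (Set.range (evalForm (X := X)))) :
    ∃ F : Finset X, ∀ u : Lip X, (∀ x ∈ F, (u : X → ℝ) x = 0) → τ u = 0 := by
  classical
  induction hτ using Submodule.span_induction with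
  | mem σ h =>
    obtain ⟨x, rfl⟩ := h
    exact ⟨{x}, fun u hu => hu x (Finset.mem_singleton_self x)⟩
  | zero => exact ⟨∅, fun _ _ => rfl⟩
  | add σ ρ _ _ h1 h2 =>
    obtain ⟨F, hF⟩ := h1
    obtain ⟨F', hF'⟩ := h2
    refine ⟨F ∪ F', fun u hu => ?_⟩
    rw [LinearMap.add_apply, hF u fun x hx => hu x (Finset.mem_union_left _ hx),
      hF' u fun x hx => hu x (Finset.mem_union_right _ hx), add_zero]
  | smul c σ _ h =>
    obtain ⟨F, hF⟩ := h
    exact ⟨F, fun u hu => by rw [LinearMap.smul_apply, hF u hu, smul_zero]⟩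

/-- This keeps the remainder finitely determined after each correction, so that the approximation
can be iterated. -/
theorem finitelyDetermined_of_mem_span_evalForm {τ : Lip X →ₗ[ℝ] ℝ}
    (hτ : τ ∈ Submodule.span ℝ (Set.range (evalForm (X := X)))) : FinitelyDetermined τ := by
  intro ε hε
  obtain ⟨F, hF⟩ := exists_finset_of_mem_span_evalForm hτ
  refine ⟨F, fun u hu => ?_⟩
  rw [hF u hu, abs_zero]
  exact mul_nonneg hε.le (lipConst_nonneg _)

variable [MeasurableSpace X] [BorelSpace X]

theorem exists_measure_of_mem_span_evalForm {τ : Lip X →ₗ[ℝ] ℝ}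
    (hτ : τ ∈ Submodule.span ℝ (Set.range (evalForm (X := X)))) :
    ∃ ν : Measure X, IsFiniteMeasure ν ∧ ∀ f : LipB X,
      |τ (Submodule.inclusion (lipB_le_lip X) f)| ≤ ∫ x, |(f : X → ℝ) x| ∂ν := by
  induction hτ using Submodule.span_induction with
  | mem σ h =>
    obtain ⟨x, rfl⟩ := h
    refine ⟨Measure.dirac x, inferInstance, fun f => ?_⟩
    rw [integral_dirac]
    rfl
  | zero => exact ⟨0, inferInstance, fun f => by simp⟩
  | add σ ρ _ _ h1 h2 =>
    obtain ⟨μ, _, h1⟩ := h1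
    obtain ⟨ν, _, h2⟩ := h2
    refine ⟨μ + ν, inferInstance, fun f => ?_⟩
    rw [integral_add_measure (integrable_lipB f μ) (integrable_lipB f ν)]
    exact (abs_add_le _ _).trans (add_le_add (h1 f) (h2 f))
  | smul c σ _ h =>
    obtain ⟨μ, _, h⟩ := h
    refine ⟨‖c‖₊ • μ, inferInstance, fun f => ?_⟩
    rw [integral_smul_nnreal_measure, NNReal.smul_def, coe_nnnorm, Real.norm_eq_abs, smul_eq_mul,
      LinearMap.smul_apply, smul_eq_mul, abs_mul]
    exact mul_le_mul_of_nonneg_left (h f) (abs_nonneg c)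

/-- For a 0-current locality is vacuous and joint continuity trivial, so only a finite mass bound is
needed, and a weighted sum of Dirac measures provides it. -/
theorem isMetricCurrent_boundary_of_mem_span_evalForm {S : Functional X 1}
    (hS : boundaryForm S ∈ Submodule.span ℝ (Set.range (evalForm (X := X)))) :
    IsMetricCurrent (boundary S) where
  locality := fun _ _ ⟨i, _⟩ => i.elim0
  joint_continuity f π πs _ _ := by
    have h : ∀ n, πs n = π := fun n => Subsingleton.elim _ _
    simp only [h]
    exact tendsto_const_nhds
  finite_mass := by
    obtain ⟨ν, hν, h⟩ := exists_measure_of_mem_span_evalForm hS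
    refine ⟨ν, hν, fun f π => ?_⟩
    have hπ : (Fin.cons (Submodule.inclusion (lipB_le_lip X) f) π : Fin 1 → Lip X) =
        fun _ => Submodule.inclusion (lipB_le_lip X) f := by
      funext i
      obtain rfl := Fin.fin_one_eq_zero i
      rfl
    rw [boundary_apply, hπ, Finset.univ_eq_empty, Finset.prod_empty, one_mul]
    exact h f

end FiniteBoundary

/-! ### Filling the boundary by currents of controlled mass -/

section Approximation

variable {X : Type*} [MetricSpace X] [MeasurableSpace X] [BorelSpace X]

/-- In a quasiconvex space, a finitely determined functional is approximated by boundaries of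
currents of comparable mass. -/
theorem IsQuasiconvex.exists_current_boundaryForm_near (hX : IsQuasiconvex X) :
    ∃ L : NNReal, ∀ (τ : Lip X →ₗ[ℝ] ℝ) (η ε : ℝ), FinitelyDetermined τ → 0 ≤ η → 0 < ε →
      (∀ u : Lip X, |τ u| ≤ η * lipConst (u : X → ℝ)) →
      ∃ (G : Functional X 1) (ν : Measure X), IsMetricCurrent G ∧ IsMassBound G ν ∧
        ν Set.univ ≤ L * ENNReal.ofReal η ∧
        boundaryForm G ∈ Submodule.span ℝ (Set.range (evalForm (X := X))) ∧
        ∀ u : Lip X, |τ u - boundaryForm G u| ≤ ε * lipConst (u : X → ℝ) := by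
  obtain ⟨L, hL⟩ := hX.exists_current
  choose G ν hG hν hνL hb using hL
  refine ⟨L, fun τ η ε hτ hη hε hle => ?_⟩
  obtain ⟨F, a, ha, hτa⟩ := hτ.exists_molecule hη hle hε
  -- The normalization of the molecule cancels the factor `d(x, y)` in the mass of the filling
  -- curve. On the diagonal `c p = 0`, by division by zero.
  let c : F × F → ℝ := fun p => a p / dist (p.1 : X) p.2
  have hmass : ∑' p : F × F, (‖c p‖₊ • ν p.1 p.2) Set.univ ≤ L * ENNReal.ofReal η := by
    rw [tsum_fintype]
    calc ∑ p : F × F, (‖c p‖₊ • ν p.1 p.2) Set.univ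
        ≤ ∑ p, L * ENNReal.ofReal |a p| := by
          refine Finset.sum_le_sum fun p _ => ?_
          rw [Measure.smul_apply, ENNReal.smul_def, smul_eq_mul]
          refine (mul_le_mul_right (hνL p.1 p.2) _).trans ?_
          rw [mul_left_comm]
          refine mul_le_mul_right ?_ _
          rw [edist_dist, ← enorm_eq_nnnorm, Real.enorm_eq_ofReal_abs,
            ← ENNReal.ofReal_mul (abs_nonneg _), abs_div, abs_of_nonneg dist_nonneg]
          refine ENNReal.ofReal_le_ofReal ?_
          rcases eq_or_ne (dist (p.1 : X) p.2) 0 with h | h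
          · simp [h]
          · rw [div_mul_cancel₀ _ h]
      _ = L * ENNReal.ofReal (∑ p, |a p|) := by
          rw [← Finset.mul_sum, ENNReal.ofReal_sum_of_nonneg fun p _ => abs_nonneg _]
      _ ≤ _ := mul_le_mul_right (ENNReal.ofReal_le_ofReal ha) _
  obtain ⟨D, hD, hDμ, hDsum⟩ := exists_hasSum_current (fun p : F × F => (hG p.1 p.2).smul (c p))
    (fun p => (hν p.1 p.2).smul (c p))
    (ne_top_of_le_ne_top (ENNReal.mul_ne_top ENNReal.coe_ne_top ENNReal.ofReal_ne_top) hmass)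
  have hDb : ∀ u : Lip X, boundaryForm D u =
      ∑ p : F × F, c p * ((u : X → ℝ) p.1 - (u : X → ℝ) p.2) := fun u => by
    refine ((hDsum (oneLipB X) fun _ => u).unique (hasSum_fintype _)).trans ?_
    refine Finset.sum_congr rfl fun p _ => ?_
    rw [← hb]
    rfl
  refine ⟨D, _, hD, hDμ, ?_, ?_, fun u => ?_⟩
  · rwa [Measure.sum_apply _ MeasurableSet.univ]
  · have h : boundaryForm D = ∑ p : F × F, c p • (evalForm (p.1 : X) - evalForm (p.2 : X)) := by
      ext u
      rw [hDb, LinearMap.sum_apply]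
      rfl
    rw [h]
    exact Submodule.sum_mem _ fun p _ => Submodule.smul_mem _ _ (Submodule.sub_mem _
      (Submodule.subset_span ⟨_, rfl⟩) (Submodule.subset_span ⟨_, rfl⟩))
  · refine le_trans (le_of_eq ?_) (hτa u)
    rw [hDb]
    congr 2
    refine Finset.sum_congr rfl fun p _ => ?_
    change a p / _ * _ = a p * (_ / _)
    rw [div_mul_eq_mul_div, mul_div_assoc]

/-- In a quasiconvex space, a current with finitely determined boundary is the sum of a convergent
series of currents of summable mass, up to a current without boundary. -/
theorem IsQuasiconvex.exists_seq_currents (hX : IsQuasiconvex X) {T : Functional X 1}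
    (hT : IsMetricCurrent T) (hfd : FinitelyDetermined (boundaryForm T)) :
    ∃ (G : ℕ → Functional X 1) (ν : ℕ → Measure X), (∀ n, IsMetricCurrent (G n)) ∧
      (∀ n, IsMassBound (G n) (ν n)) ∧ ∑' n, ν n Set.univ ≠ ⊤ ∧
      (∀ n, boundaryForm (G n) ∈ Submodule.span ℝ (Set.range (evalForm (X := X)))) ∧
      ∀ u : Lip X, Tendsto (fun n => ∑ k ∈ Finset.range n, boundaryForm (G k) u) atTop
        (𝓝 (boundaryForm T u)) := by
  obtain ⟨L, hL⟩ := hX.exists_current_boundaryForm_near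
  obtain ⟨μ, hμ⟩ := hT.finite_mass
  -- `ε 0` bounds the norm of the boundary of `T`; adding `1` keeps the errors positive when `μ` is
  -- zero. The error `ε (n + 1)` allowed at one step is the norm bound at the next.
  let ε : ℕ → ℝ := fun n => (μ.real Set.univ + 1) * (1 / 2) ^ n
  have hM : 0 < μ.real Set.univ + 1 := by positivity
  have hε : ∀ n, 0 < ε n := fun n => by positivity
  let P : ℕ → (Lip X →ₗ[ℝ] ℝ) → Prop := fun n τ =>
    FinitelyDetermined τ ∧ ∀ u : Lip X, |τ u| ≤ ε n * lipConst (u : X → ℝ)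
  have step : ∀ (n : ℕ) (τ : {τ // P n τ}), ∃ (G : Functional X 1) (ν : Measure X),
      IsMetricCurrent G ∧ IsMassBound G ν ∧ ν Set.univ ≤ L * ENNReal.ofReal (ε n) ∧
      boundaryForm G ∈ Submodule.span ℝ (Set.range (evalForm (X := X))) ∧
      P (n + 1) (τ.1 - boundaryForm G) := fun n τ => by
    obtain ⟨G, ν, h1, h2, h3, h4, h5⟩ :=
      hL τ.1 (ε n) (ε (n + 1)) τ.2.1 (hε n).le (hε (n + 1)) τ.2.2
    exact ⟨G, ν, h1, h2, h3, h4, τ.2.1.sub (finitelyDetermined_of_mem_span_evalForm h4), h5⟩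
  choose G ν h1 h2 h3 h4 h5 using step
  have hP0 : P 0 (boundaryForm T) := ⟨hfd, fun u => (hμ.abs_boundaryForm_le u).trans
    (mul_le_mul_of_nonneg_right (by simp [ε]) (lipConst_nonneg _))⟩
  let τ : ∀ n, {τ // P n τ} := fun n =>
    Nat.rec ⟨boundaryForm T, hP0⟩ (fun m σ => ⟨σ.1 - boundaryForm (G m σ), h5 m σ⟩) n
  refine ⟨fun n => G n (τ n), fun n => ν n (τ n), fun n => h1 n _, fun n => h2 n _, ?_,
    fun n => h4 n _, fun u => ?_⟩
  · refine ne_top_of_le_ne_top ?_ (ENNReal.tsum_le_tsum fun n => h3 n (τ n))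
    rw [ENNReal.tsum_mul_left]
    refine ENNReal.mul_ne_top ENNReal.coe_ne_top ?_
    exact (summable_geometric_two.mul_left _).tsum_ofReal_ne_top
  · have hsum : ∀ n, ∑ k ∈ Finset.range n, boundaryForm (G k (τ k)) u =
        boundaryForm T u - (τ n).1 u := by
      intro n
      induction n with
      | zero => exact (sub_self _).symm
      | succ n ih =>
        rw [Finset.sum_range_succ, ih]
        change _ = _ - ((τ n).1 u - boundaryForm (G n (τ n)) u)
        ring
    have hε0 : Tendsto (fun n => ε n * lipConst (u : X → ℝ)) atTop (𝓝 0) := by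
      have h := ((tendsto_pow_atTop_nhds_zero_of_lt_one (r := (1 / 2 : ℝ)) (by norm_num)
        (by norm_num)).const_mul (μ.real Set.univ + 1)).mul_const (lipConst (u : X → ℝ))
      simpa [ε] using h
    have hτ0 : Tendsto (fun n => (τ n).1 u) atTop (𝓝 0) :=
      squeeze_zero_norm (fun n => (τ n).2.2 u) hε0
    simp only [hsum]
    simpa using hτ0.const_sub (boundaryForm T u)

end Approximation

end MetricCurrents

/-! ### Removing the tails -/

open MetricCurrents in
theorem theorem1p2 {X : Type*} [MetricSpace X] [CompleteSpace X] [MeasurableSpace X]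
    [BorelSpace X] (hX : MetricCurrents.IsQuasiconvex X)
    (T : MetricCurrents.Functional X 1) (hT : MetricCurrents.IsMetricCurrent T)
    (hreg : (MetricCurrents.massMeasure T).InnerRegular) :
    ∃ S : ℕ → MetricCurrents.Functional X 1,
      (∀ i, MetricCurrents.IsNormalCurrent (S i)) ∧
      Tendsto (fun i => MetricCurrents.mass (T - S i)) atTop (𝓝 0) := by
  obtain ⟨G, ν, hG, hν, hfin, hspan, hlim⟩ := hX.exists_seq_currents hT
    (hT.finitelyDetermined_boundaryForm (massMeasure_isLeast hT.finite_mass).1 hreg)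
  have htail := ENNReal.tendsto_sum_nat_add _ hfin
  have hfin' : ∀ n, ∑' k, ν (k + n) Set.univ ≠ ⊤ := fun n =>
    ne_top_of_le_ne_top hfin (ENNReal.tsum_comp_le_tsum_of_injective (add_left_injective n) _)
  choose D hD hDν hDsum using fun n => exists_hasSum_current (fun k => hG (k + n))
    (fun k => hν (k + n)) (hfin' n)
  -- The boundary of `T` is the full series and that of `D n` its tail from index `n`, so their
  -- difference is a finite sum.
  have hb : ∀ n, boundaryForm (T - D n) = ∑ k ∈ Finset.range n, boundaryForm (G k) := by
    intro n
    ext u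
    have h1 : Tendsto (fun m => ∑ k ∈ Finset.range m, boundaryForm (G (k + n)) u) atTop
        (𝓝 (boundaryForm (D n) u)) := (hDsum n (oneLipB X) fun _ => u).tendsto_sum_nat
    have h2 : Tendsto (fun m => ∑ k ∈ Finset.range (n + m), boundaryForm (G k) u) atTop
        (𝓝 (boundaryForm T u)) := by
      simpa only [add_comm n] using (tendsto_add_atTop_iff_nat n).2 (hlim u)
    have h3 : Tendsto (fun m => ∑ k ∈ Finset.range (n + m), boundaryForm (G k) u -
        ∑ k ∈ Finset.range m, boundaryForm (G (k + n)) u) atTop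
        (𝓝 (∑ k ∈ Finset.range n, boundaryForm (G k) u)) := by
      refine tendsto_const_nhds.congr fun m => ?_
      rw [Finset.sum_range_add, eq_sub_iff_add_eq]
      simp only [add_comm n]
    rw [boundaryForm_sub, tendsto_nhds_unique (h2.sub h1) h3, LinearMap.sum_apply]
  refine ⟨fun n => T - D n, fun n => ⟨hT.sub (hD n),
    isMetricCurrent_boundary_of_mem_span_evalForm ?_⟩, ?_⟩
  · rw [hb]
    exact Submodule.sum_mem _ fun k _ => hspan k
  · refine tendsto_of_tendsto_of_tendsto_of_le_of_le tendsto_const_nhds htail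
      (fun _ => zero_le) fun n => ?_
    have h : massMeasure (D n) ≤ Measure.sum fun k => ν (k + n) := sInf_le (hDν n)
    have hTD : T - (T - D n) = D n := sub_sub_cancel T (D n)
    rw [hTD]
    exact (h Set.univ).trans_eq (Measure.sum_apply _ MeasurableSet.univ)
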